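/- Graphs are finite and may have parallel edges but no loops; a graph is simple if it has no parallel edges. For a graph $G$ and $S\subseteq V(G)$, let $\partial(S)$ be the set of edges with precisely one end in $S$, and let $N_G(S)$ be the set of vertices outside $S$ that are adjacent to a vertex of $S$. An $r$-graph is an $r$-regular graph $G$ with $|\partial(S)|\ge r$ for every $S\subseteq V(G)$ of odd cardinality. For $r,i\ge 1$, $T_i^r$ denotes the tree all of whose vertex degrees are in $\{1,r\}$ and which has a vertex of degree $r$, the root, at distance $i$ from every leaf other than the root itself (for $r=1$ the tree is a single edge, $i=1$, and either end may be taken as the root; for $r\ge 2$ the root is not a leaf). An automorphism of a graph $G$ is a permutation $\alpha$ of $V(G)$ such that for all $u,v\in V(G)$ the number of edges between $\alpha(u)$ and $\alpha(v)$ equals the number of edges between $u$ and $v$. An automorphism $\alpha$ of a tree $T$ is rotational with respect to a vertex $v$ if $\alpha(v)=v$ and, for every vertex $u\neq v$, the smallest positive integer $k$ with $\alpha^k(u)=u$ is $d_T(v)$. A rotation $r$-graph is an $r$-graph $G$ that, for some $i$, has a spanning tree $T$ isomorphic to $T_i^r$ and an automorphism that is also an automorphism of $T$ and is rotational on $T$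 with respect to the root. Let $G$ be an $r$-graph and let $S\subseteq V(G)$ be a set of even cardinality with $|\partial(S)|=2$ and $N_G(S)=\{u,v\}$, $u\ne v$. The graph obtained from $G$ by deleting the vertices of $S$ together with all edges that have an end in $S$, and adding a new edge $uv$, is said to be obtained from $G$ by a $2$-cut reduction. **Theorem.** Let $r$ be a positive odd integer. For every connected (non-empty) $r$-graph $G$ there is a simple rotation $r$-graph $G'$ such that $G$ can be obtained, up to isomorphism, from $G'$ by a finite number (possibly zero) of $2$-cut reductions. -/

import Mathlib

universe u

/-- A graph on the vertex set `V` that may have parallel edges but no loops, given by the number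
`mult x y` of edges between any two vertices. -/
structure Multigraph (V : Type u) : Type u where
  /-- The number of edges between two vertices. -/
  mult : V → V → ℕ
  mult_comm : ∀ x y, mult x y = mult y x
  mult_self : ∀ x, mult x x = 0

namespace Multigraph

/-- No parallel edges. -/
def IsSimple {V : Type u} (G : Multigraph V) : Prop :=
  ∀ x y, G.mult x y ≤ 1

/-- The degree of a vertex, parallel edges counted with multiplicity. -/
def degree {V : Type u} [Fintype V] (G : Multigraph V) (x : V) : ℕ :=
  ∑ y, G.mult x y

/-- Every vertex has degree `r`. -/
def IsRegular {V : Type u} [Fintype V] (G : Multigraph V) (r : ℕ) : Prop :=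
  ∀ x, G.degree x = r

/-- The simple graph on the same vertices in which two vertices are adjacent if at least one
edge of `G` joins them. -/
def toSimpleGraph {V : Type u} (G : Multigraph V) : SimpleGraph V where
  Adj x y := 0 < G.mult x y
  symm := ⟨fun x y h => by rw [G.mult_comm y x]; exact h⟩
  loopless := ⟨fun x h => by rw [G.mult_self x] at h; exact absurd h (Nat.lt_irrefl 0)⟩

/-- Connected graphs; in particular the vertex set is not empty. -/
def Connected {V : Type u} (G : Multigraph V) : Prop :=
  G.toSimpleGraph.Connected

open scoped Classical in
/-- `|∂(S)|`: the number of edges with precisely one end in `S`. -/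
noncomputable def cutSize {V : Type u} [Fintype V] (G : Multigraph V) (S : Finset V) : ℕ :=
  ∑ x ∈ S, ∑ y ∈ Sᶜ, G.mult x y

/-- `N(S)`: the vertices outside `S` that are adjacent to a vertex of `S`. -/
def neighborSet {V : Type u} (G : Multigraph V) (S : Finset V) : Set V :=
  {y | y ∉ S ∧ ∃ x ∈ S, 0 < G.mult x y}

/-- An `r`-graph: an `r`-regular graph with `|∂(S)| ≥ r` for every vertex set `S` of odd
cardinality. -/
def IsRGraph {V : Type u} [Fintype V] (G : Multigraph V) (r : ℕ) : Prop :=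
  G.IsRegular r ∧ ∀ S : Finset V, Odd S.card → r ≤ G.cutSize S

/-- Isomorphism of multigraphs. -/
def IsIsomorphic {V W : Type u} (G : Multigraph V) (H : Multigraph W) : Prop :=
  ∃ e : V ≃ W, ∀ x y, H.mult (e x) (e y) = G.mult x y

/-- An automorphism: a permutation of the vertices that preserves the number of edges between
any two vertices. -/
def IsAutomorphism {V : Type u} (G : Multigraph V) (α : Equiv.Perm V) : Prop :=
  ∀ x y, G.mult (α x) (α y) = G.mult x y

open scoped Classical in
/-- `T` is (isomorphic to) the tree `T_i^r`, with root `v`: all degrees are in `{1, r}`, and `v`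
is a vertex of degree `r` that has distance `i` to every leaf (other than `v`, which matters only
for `r = 1`, where the tree is a single edge). -/
def IsRootedTree {V : Type u} [Fintype V] (T : SimpleGraph V) (r i : ℕ) (v : V) : Prop :=
  T.IsTree ∧ (∀ x, T.degree x = 1 ∨ T.degree x = r) ∧ T.degree v = r ∧
    ∀ x, x ≠ v → T.degree x = 1 → T.dist v x = i

open scoped Classical in
/-- `α` is an automorphism of the tree `T` that is rotational with respect to `v`: it fixes `v`,
and for every other vertex `x` the smallest positive `k` with `(α ^ k) x = x` is the degree of `v`
in `T`. -/
def IsRotational {V : Type u} [Fintype V] (T : SimpleGraph V) (v : V)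
    (α : Equiv.Perm V) : Prop :=
  (∀ x y, T.Adj (α x) (α y) ↔ T.Adj x y) ∧ Function.minimalPeriod α v = 1 ∧
    ∀ x, x ≠ v → Function.minimalPeriod α x = T.degree v

/-- A rotation `T_i^r`-graph: an `r`-regular graph with a spanning tree `T` isomorphic to `T_i^r`
and an automorphism that is rotational on `T` with respect to the root. -/
def IsRotationTreeGraph {V : Type u} [Fintype V] (G : Multigraph V) (r i : ℕ) : Prop :=
  G.IsRegular r ∧ ∃ (T : SimpleGraph V) (v : V) (α : Equiv.Perm V),
    T ≤ G.toSimpleGraph ∧ IsRootedTree T r i v ∧ G.IsAutomorphism α ∧ IsRotational T v α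

/-- A rotation `r`-graph: an `r`-graph that is a rotation `T_i^r`-graph for some `i`. -/
def IsRotationRGraph {V : Type u} [Fintype V] (G : Multigraph V) (r : ℕ) : Prop :=
  G.IsRGraph r ∧ ∃ i : ℕ, G.IsRotationTreeGraph r i

open scoped Classical in
/-- Delete the vertices of `S` (with all edges that have an end in `S`) and add one new edge
between the distinct remaining vertices `u` and `v`. -/
noncomputable def deleteAddEdge {V : Type u} (G : Multigraph V) (S : Finset V) (u v : V)
    (huv : u ≠ v) : Multigraph {x : V // x ∉ S} where
  mult x y := G.mult x y +
    if (x.1 = u ∧ y.1 = v) ∨ (x.1 = v ∧ y.1 = u) then 1 else 0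
  mult_comm x y := by
    rw [G.mult_comm]
    congr 1
    exact if_congr (by tauto) rfl rfl
  mult_self x := by
    rw [G.mult_self, if_neg]
    rintro (⟨h1, h2⟩ | ⟨h1, h2⟩)
    · exact huv (h1.symm.trans h2)
    · exact huv (h2.symm.trans h1)

/-- `H.IsObtainedFrom r G`: the graph `H` is obtained, up to isomorphism, from `G` by a finite
number (possibly zero) of 2-cut reductions. One 2-cut reduction takes an `r`-graph `G` and a
vertex set `S` of even cardinality with `|∂(S)| = 2` and `N(S) = {u, v}`, deletes `S` and adds
an edge `uv`. -/
inductive IsObtainedFrom {W : Type u} (H : Multigraph W) (r : ℕ) :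
    {V : Type u} → Multigraph V → Prop
  | iso {V : Type u} (G : Multigraph V) (h : G.IsIsomorphic H) : IsObtainedFrom H r G
  | reduction {V : Type u} [Fintype V] (G : Multigraph V) (hG : G.IsRGraph r)
      (S : Finset V) (u v : V) (huv : u ≠ v) (hS : Even S.card) (hcut : G.cutSize S = 2)
      (hN : G.neighborSet S = {u, v})
      (h : IsObtainedFrom H r (G.deleteAddEdge S u v huv)) : IsObtainedFrom H r G

end Multigraph

/-! For r = 1 the graph is a single edge and is itself a rotation graph, with the identity as
automorphism. Let r = 2h + 1 with h > 0.

Composition: remove an edge st from H and an edge xy from K, then add the edges sx and ty. For odd r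
this turns r-graphs into an r-graph (`Substitution.Replaces.isRGraph`). The two sides are joined by
exactly two edges, so one 2-cut reduction recovers H, and reducing the other side recovers K
(`isObtainedFrom_base`, `isObtainedFrom_piece`).

Building block: a root with r branches, each a complete 2h-ary tree of arbitrary positive height,
together with a circulant graph of degree 2h on all the leaves. This star is a simple r-graph
(`Star.graph_isRGraph`), because forests have few inner edges and the circulant has no cut smaller
than 2h.

Trimming (`IsRGraph.exists_trimmed`): pick an edge xy of G. It is not a bridge, so G - xy has a
spanning tree with root x. Compose a star into every edge other than xy that is outside the tree,
with heights that put all leaves of the stars at a common depth D of the enlarged tree. This gives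
an r-graph K that reduces to G, and every edge of K - xy outside the enlarged tree joins two leaves
of depth D.

Symmetrising (`IsRGraph.exists_rotation`): take a star with r equal branches whose circulant is
invariant under cyclic rotation of the branches, and compose a copy of K, along xy, into each edge
at the root. The root is now joined to the copies of x, and each copy of y carries a branch of
height D - dep y, so all leaves have depth D + 1. Rotating the r sectors moves every vertex except
the centre in an orbit of length r. Reducing everything outside one copy gives K, hence G. -/

set_option linter.unusedSectionVars false

/-! ### Cuts and their parity -/

namespace Multigraph

open scoped Classical in
/-- The number of edges between `x` and `y` in the graph whose only edge is `ab`. -/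
noncomputable def edgeCount {V : Type*} (a b x y : V) : ℕ :=
  if (x = a ∧ y = b) ∨ (x = b ∧ y = a) then 1 else 0

open scoped Classical in
/-- The number (0 or 1) of edges in the cut of a single edge, given on which side its ends lie. -/
noncomputable def sep (p q : Prop) : ℕ := if (p ↔ q) then 0 else 1

theorem edgeCount_comm {V : Type*} (a b x y : V) : edgeCount a b x y = edgeCount a b y x := by
  classical
  unfold edgeCount
  exact if_congr (by tauto) rfl rfl

open scoped Classical in
theorem edgeCount_eq {V : Type*} {a b : V} (hab : a ≠ b) (x y : V) :
    edgeCount a b x y = (if x = a ∧ y = b then 1 else 0) + (if x = b ∧ y = a then 1 else 0) := by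
  unfold edgeCount
  by_cases h1 : x = a ∧ y = b
  · simp [h1, hab]
  · simp [h1]

theorem edgeCount_self {V : Type*} {a b : V} (hab : a ≠ b) (x : V) : edgeCount a b x x = 0 := by
  unfold edgeCount
  rw [if_neg]
  rintro (⟨h1, h2⟩ | ⟨h1, h2⟩)
  · exact hab (h1.symm.trans h2)
  · exact hab (h2.symm.trans h1)

open scoped Classical in
theorem sum_edgeCount {V : Type*} [Fintype V] {a b : V} (hab : a ≠ b) (x : V) :
    ∑ y, edgeCount a b x y = (if x = a then 1 else 0) + (if x = b then 1 else 0) := by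
  simp only [edgeCount_eq hab, Finset.sum_add_distrib, ite_and]
  by_cases h1 : x = a <;> by_cases h2 : x = b <;> simp [h1, h2]

open scoped Classical in
theorem cutSize_eq_sum {V : Type*} [Fintype V] (G : Multigraph V) (S : Finset V) :
    G.cutSize S = ∑ x, ∑ y, if x ∈ S ∧ y ∉ S then G.mult x y else 0 := by
  unfold cutSize
  rw [← Finset.sum_filter_add_sum_filter_not Finset.univ (· ∈ S)
    (fun x => ∑ y, if x ∈ S ∧ y ∉ S then G.mult x y else 0)]
  rw [Finset.sum_eq_zero (s := Finset.univ.filter (¬ · ∈ S)), add_zero]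
  · have : Finset.univ.filter (· ∈ S) = S := by ext; simp
    rw [this]
    refine Finset.sum_congr rfl fun x hx => ?_
    rw [← Finset.sum_filter]
    refine Finset.sum_congr ?_ fun _ _ => rfl
    ext; simp [hx]
  · intro x hx
    simp only [Finset.mem_filter, Finset.mem_univ, true_and] at hx
    simp [hx]

open scoped Classical in
theorem cut_edgeCount {V : Type*} [Fintype V] {a b : V} (hab : a ≠ b) (S : Finset V) :
    (∑ x, ∑ y, if x ∈ S ∧ y ∉ S then edgeCount a b x y else 0) = sep (a ∈ S) (b ∈ S) := by
  have key : ∀ x y, (if x ∈ S ∧ y ∉ S then edgeCount a b x y else 0) =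
      (if x = a then if y = b then (if a ∈ S ∧ b ∉ S then 1 else 0) else 0 else 0) +
      (if x = b then if y = a then (if b ∈ S ∧ a ∉ S then 1 else 0) else 0 else 0) := by
    intro x y
    rw [edgeCount_eq hab]
    by_cases h1 : x = a <;> by_cases h2 : y = b <;> by_cases h3 : x = b <;> by_cases h4 : y = a <;>
      simp_all
  simp only [key, Finset.sum_add_distrib]
  rw [Finset.sum_eq_single a (by intro x _ hx; simp [hx]) (by simp)]
  rw [Finset.sum_eq_single b (by intro x _ hx; simp [hx]) (by simp)]
  rw [Finset.sum_eq_single b (by intro x _ hx; simp [hx]) (by simp)]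
  rw [Finset.sum_eq_single a (by intro x _ hx; simp [hx]) (by simp)]
  unfold sep
  by_cases ha : a ∈ S <;> by_cases hb : b ∈ S <;> simp [ha, hb]

theorem cutSize_add_edges {V : Type*} [Fintype V] {J : Type*} [Fintype J] (G M : Multigraph V)
    (s t : J → V) (hst : ∀ j, s j ≠ t j)
    (h : ∀ x y, G.mult x y = M.mult x y + ∑ j, edgeCount (s j) (t j) x y) (S : Finset V) :
    G.cutSize S = M.cutSize S + ∑ j, sep (s j ∈ S) (t j ∈ S) := by
  classical
  simp only [cutSize_eq_sum]
  have : ∀ j, sep (s j ∈ S) (t j ∈ S) = _ := fun j => (cut_edgeCount (hst j) S).symm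
  simp only [this]
  rw [Finset.sum_comm (s := (Finset.univ : Finset J)), ← Finset.sum_add_distrib]
  refine Finset.sum_congr rfl fun x _ => ?_
  rw [Finset.sum_comm (s := (Finset.univ : Finset J)), ← Finset.sum_add_distrib]
  refine Finset.sum_congr rfl fun y _ => ?_
  by_cases hx : x ∈ S ∧ y ∉ S <;> simp [hx, h]

theorem cutSize_add_edge {V : Type*} [Fintype V] (G M : Multigraph V)
    {a b : V} (hab : a ≠ b)
    (h : ∀ x y, G.mult x y = M.mult x y + edgeCount a b x y) (S : Finset V) :
    G.cutSize S = M.cutSize S + sep (a ∈ S) (b ∈ S) := by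
  simpa using cutSize_add_edges (J := Unit) G M (fun _ => a) (fun _ => b) (fun _ => hab)
    (by simpa using h) S

theorem even_sum_symm {V : Type*} (G : Multigraph V) (S : Finset V) :
    Even (∑ x ∈ S, ∑ y ∈ S, G.mult x y) := by
  classical
  induction S using Finset.induction_on with
  | empty => simp
  | insert a S ha ih =>
    have : ∀ x, ∑ y ∈ insert a S, G.mult x y = G.mult x a + ∑ y ∈ S, G.mult x y := fun x =>
      Finset.sum_insert ha
    simp only [this]
    rw [Finset.sum_insert ha, G.mult_self, Finset.sum_add_distrib, zero_add, ← add_assoc]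
    refine Even.add ?_ ih
    simp only [G.mult_comm a]
    exact ⟨_, rfl⟩

theorem sum_degree_eq {V : Type*} [Fintype V] (G : Multigraph V) (S : Finset V) :
    ∑ x ∈ S, G.degree x = G.cutSize S + ∑ x ∈ S, ∑ y ∈ S, G.mult x y := by
  classical
  unfold cutSize degree
  rw [← Finset.sum_add_distrib]
  refine Finset.sum_congr rfl fun x _ => ?_
  rw [add_comm]
  convert (Finset.sum_add_sum_compl S _).symm

/-- Summing degrees over `S` counts inner edges twice, so the cut has the parity of `r` times the
order of `S`. -/
theorem IsRegular.even_cutSize {V : Type*} [Fintype V] {G : Multigraph V} {r : ℕ}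
    (h : G.IsRegular r) (S : Finset V) : Even (G.cutSize S) ↔ Even (S.card * r) := by
  have h1 := sum_degree_eq G S
  rw [Finset.sum_congr rfl (fun x _ => h x), Finset.sum_const, smul_eq_mul] at h1
  rw [h1]
  have := even_sum_symm G S
  rw [Nat.even_add]
  tauto

theorem cutSize_compl {V : Type*} [Fintype V] [DecidableEq V] (G : Multigraph V) (S : Finset V) :
    G.cutSize Sᶜ = G.cutSize S := by
  simp only [cutSize_eq_sum]
  rw [Finset.sum_comm]
  refine Finset.sum_congr rfl fun x _ => Finset.sum_congr rfl fun y _ => ?_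
  rw [G.mult_comm]
  by_cases hx : x ∈ S <;> by_cases hy : y ∈ S <;> simp [hx, hy]

theorem IsRegular.even_card {V : Type*} [Fintype V] {G : Multigraph V} {r : ℕ}
    (h : G.IsRegular r) (hr : Odd r) : Even (Fintype.card V) := by
  have h1 := h.even_cutSize Finset.univ
  have h2 : G.cutSize Finset.univ = 0 := by simp [cutSize]
  rw [h2, Nat.even_mul] at h1
  have := h1.1 (by simp)
  rcases this with h | h
  · exact h
  · exact absurd hr (by simpa using h)

theorem IsRegular.even_card_of_even_cutSize {V : Type*} [Fintype V] {G : Multigraph V} {r : ℕ}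
    (h : G.IsRegular r) (hr : Odd r) {S : Finset V} (hS : Even (G.cutSize S)) : Even S.card := by
  have h1 := (h.even_cutSize S).1 hS
  rw [Nat.even_mul] at h1
  rcases h1 with h | h
  · exact h
  · exact absurd hr (by simpa using h)

/-- The cut is odd and `r - 1` is even, so a bound of `r - 1` improves to `r`. This repairs the loss
of one edge in later estimates. -/
theorem IsRegular.le_cutSize_of_odd {V : Type*} [Fintype V] {G : Multigraph V} {r : ℕ}
    (h : G.IsRegular r) (hr : Odd r) {S : Finset V} (hS : Odd S.card)
    (hc : r ≤ G.cutSize S + 1) : r ≤ G.cutSize S := by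
  have h1 : ¬ Even (G.cutSize S) := by
    rw [h.even_cutSize, Nat.even_mul]
    simp [hS, hr]
  rw [Nat.not_even_iff_odd] at h1
  obtain ⟨a, ha⟩ := hr
  obtain ⟨b, hb⟩ := h1
  omega

end Multigraph

/-! ### Substituting graphs for edges -/

namespace Multigraph

/-- Data for replacing a family of edges `s j – t j` of a graph on `B` by graphs `piece j`, each
with two distinguished vertices `x j` and `y j` that get joined to `s j` and `t j`; the graph
`base` consists of the edges that are kept. -/
structure Substitution (B J : Type*) (W : J → Type*) where
  base : Multigraph B
  s : J → B
  t : J → B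
  piece : ∀ j, Multigraph (W j)
  x : ∀ j, W j
  y : ∀ j, W j

namespace Substitution

variable {B J : Type*} {W : J → Type*}

open scoped Classical in
/-- The number of edges between a vertex of the base and a vertex of a piece. -/
noncomputable def link (σ : Substitution B J W) (u : B) (q : Σ j, W j) : ℕ :=
  (if u = σ.s q.1 ∧ q.2 = σ.x q.1 then 1 else 0) + (if u = σ.t q.1 ∧ q.2 = σ.y q.1 then 1 else 0)

open scoped Classical in
/-- The number of edges between two vertices of pieces. -/
noncomputable def inner (σ : Substitution B J W) (p q : Σ j, W j) : ℕ :=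
  if h : p.1 = q.1 then (σ.piece q.1).mult (h ▸ p.2) q.2 else 0

theorem inner_same (σ : Substitution B J W) (j : J) (v w : W j) :
    σ.inner ⟨j, v⟩ ⟨j, w⟩ = (σ.piece j).mult v w := by
  simp [inner]

theorem inner_of_ne (σ : Substitution B J W) {p q : Σ j, W j} (h : p.1 ≠ q.1) :
    σ.inner p q = 0 := by
  simp [inner, h]

theorem inner_comm (σ : Substitution B J W) (p q : Σ j, W j) : σ.inner p q = σ.inner q p := by
  obtain ⟨i, v⟩ := p
  obtain ⟨j, w⟩ := q
  by_cases h : i = j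
  · subst h
    rw [inner_same, inner_same, mult_comm]
  · rw [inner_of_ne _ h, inner_of_ne _ (Ne.symm h)]

/-- The graph resulting from a substitution. -/
noncomputable def graph (σ : Substitution B J W) : Multigraph (B ⊕ Σ j, W j) where
  mult
    | .inl u, .inl v => σ.base.mult u v
    | .inl u, .inr q => σ.link u q
    | .inr p, .inl v => σ.link v p
    | .inr p, .inr q => σ.inner p q
  mult_comm := by
    rintro (u | p) (v | q)
    · exact σ.base.mult_comm u v
    · rfl
    · rfl
    · exact σ.inner_comm p q
  mult_self := by
    rintro (u | ⟨j, w⟩)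
    · exact σ.base.mult_self u
    · exact (σ.inner_same j w w).trans ((σ.piece j).mult_self w)

theorem graph_inl_inl (σ : Substitution B J W) (u v : B) :
    σ.graph.mult (.inl u) (.inl v) = σ.base.mult u v := rfl

theorem graph_inl_inr (σ : Substitution B J W) (u : B) (q : Σ j, W j) :
    σ.graph.mult (.inl u) (.inr q) = σ.link u q := rfl

theorem graph_inr_inl (σ : Substitution B J W) (u : B) (q : Σ j, W j) :
    σ.graph.mult (.inr q) (.inl u) = σ.link u q := rfl

theorem graph_inr_inr (σ : Substitution B J W) (p q : Σ j, W j) :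
    σ.graph.mult (.inr p) (.inr q) = σ.inner p q := rfl

/-- `σ` replaces edges of `H` by the graphs `K j`, of which one edge `x j – y j` is removed. -/
structure Replaces (σ : Substitution B J W) [Fintype J] (H : Multigraph B)
    (K : ∀ j, Multigraph (W j)) : Prop where
  s_ne_t : ∀ j, σ.s j ≠ σ.t j
  x_ne_y : ∀ j, σ.x j ≠ σ.y j
  base_eq : ∀ u v, H.mult u v = σ.base.mult u v + ∑ j, edgeCount (σ.s j) (σ.t j) u v
  piece_eq : ∀ j v w, (K j).mult v w = (σ.piece j).mult v w + edgeCount (σ.x j) (σ.y j) v w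

variable [Fintype J] [Fintype B] [∀ j, Fintype (W j)]

open scoped Classical in
theorem sum_link_piece (σ : Substitution B J W) (u : B) (j : J) :
    ∑ w, σ.link u ⟨j, w⟩ = (if u = σ.s j then 1 else 0) + (if u = σ.t j then 1 else 0) := by
  simp only [link, Finset.sum_add_distrib, ite_and]
  by_cases h1 : u = σ.s j <;> by_cases h2 : u = σ.t j <;> simp [h1, h2]

open scoped Classical in
theorem sum_link_base (σ : Substitution B J W) (j : J) (w : W j) :
    ∑ u, σ.link u ⟨j, w⟩ = (if w = σ.x j then 1 else 0) + (if w = σ.y j then 1 else 0) := by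
  simp only [link, Finset.sum_add_distrib, ite_and]
  by_cases h1 : w = σ.x j <;> by_cases h2 : w = σ.y j <;> simp [h1, h2]

/-- A general `f` serves both degree sums, where it returns the multiplicity, and cut sums, where it
also tests membership. -/
theorem sum_inner (σ : Substitution B J W) (f : (Σ j, W j) → ℕ → ℕ) (hf : ∀ q, f q 0 = 0)
    (j : J) (w : W j) :
    ∑ q, f q (σ.inner ⟨j, w⟩ q) = ∑ v, f ⟨j, v⟩ ((σ.piece j).mult w v) := by
  rw [Fintype.sum_sigma, Finset.sum_eq_single j]
  · simp only [inner_same]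
  · intro i _ hi
    refine Finset.sum_eq_zero fun v _ => ?_
    rw [inner_of_ne _ (Ne.symm hi), hf]
  · simp

variable {σ : Substitution B J W} {H : Multigraph B} {K : ∀ j, Multigraph (W j)} {r : ℕ}

theorem Replaces.isRegular (hσ : σ.Replaces H K) (hH : H.IsRegular r)
    (hK : ∀ j, (K j).IsRegular r) : σ.graph.IsRegular r := by
  classical
  rintro (u | ⟨j, w⟩)
  · rw [← hH u]
    simp only [degree, hσ.base_eq, Finset.sum_add_distrib, Fintype.sum_sum_type, Fintype.sum_sigma]
    congr 1
    rw [Finset.sum_comm]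
    refine Finset.sum_congr rfl fun j _ => ?_
    rw [sum_edgeCount (hσ.s_ne_t j)]
    exact σ.sum_link_piece u j
  · rw [← hK j w]
    simp only [degree, hσ.piece_eq, Finset.sum_add_distrib, Fintype.sum_sum_type]
    rw [sum_edgeCount (hσ.x_ne_y j), add_comm]
    congr 1
    · exact σ.sum_inner (fun _ n => n) (fun _ => rfl) j w
    · exact σ.sum_link_base j w

/-- The vertices of `X` in the base. -/
noncomputable def basePart (X : Finset (B ⊕ Σ j, W j)) : Finset B := by
  classical exact Finset.univ.filter fun u => Sum.inl u ∈ X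

/-- The vertices of `X` in the piece with index `j`. -/
noncomputable def piecePart (X : Finset (B ⊕ Σ j, W j)) (j : J) : Finset (W j) := by
  classical exact Finset.univ.filter fun w => Sum.inr ⟨j, w⟩ ∈ X

theorem mem_basePart {X : Finset (B ⊕ Σ j, W j)} {u : B} : u ∈ basePart X ↔ Sum.inl u ∈ X := by
  simp [basePart]

theorem mem_piecePart {X : Finset (B ⊕ Σ j, W j)} {j : J} {w : W j} :
    w ∈ piecePart X j ↔ Sum.inr ⟨j, w⟩ ∈ X := by
  simp [piecePart]

theorem card_eq_parts (X : Finset (B ⊕ Σ j, W j)) :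
    X.card = (basePart X).card + ∑ j, (piecePart X j).card := by
  classical
  have h : X.card = ∑ v, if v ∈ X then 1 else 0 := by simp
  rw [h, Fintype.sum_sum_type, Fintype.sum_sigma]
  simp only [basePart, piecePart, Finset.card_filter]

/-- The number of edges of the cut of `X` that lie in or lead to a given piece. -/
noncomputable def pieceCut (σ : Substitution B J W) (X : Finset (B ⊕ Σ j, W j)) (j : J) : ℕ :=
  (σ.piece j).cutSize (piecePart X j) + sep (σ.s j ∈ basePart X) (σ.x j ∈ piecePart X j) +
    sep (σ.t j ∈ basePart X) (σ.y j ∈ piecePart X j)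

open scoped Classical in
theorem sum_link_cut (σ : Substitution B J W) (S : Finset B) (j : J) (T : Finset (W j)) :
    ((∑ u, ∑ w, if u ∈ S ∧ w ∉ T then σ.link u ⟨j, w⟩ else 0) +
      ∑ w, ∑ u, if w ∈ T ∧ u ∉ S then σ.link u ⟨j, w⟩ else 0) =
    sep (σ.s j ∈ S) (σ.x j ∈ T) + sep (σ.t j ∈ S) (σ.y j ∈ T) := by
  rw [Finset.sum_comm (s := (Finset.univ : Finset (W j)))]
  simp only [← Finset.sum_add_distrib]
  have key : ∀ u w, (if u ∈ S ∧ w ∉ T then σ.link u ⟨j, w⟩ else 0) +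
      (if w ∈ T ∧ u ∉ S then σ.link u ⟨j, w⟩ else 0) =
      (if u = σ.s j then if w = σ.x j then sep (σ.s j ∈ S) (σ.x j ∈ T) else 0 else 0) +
      (if u = σ.t j then if w = σ.y j then sep (σ.t j ∈ S) (σ.y j ∈ T) else 0 else 0) := by
    intro u w
    have h1 : ∀ a : ℕ, (if u ∈ S ∧ w ∉ T then a else 0) + (if w ∈ T ∧ u ∉ S then a else 0) =
        a * sep (u ∈ S) (w ∈ T) := by
      intro a
      unfold sep
      by_cases hu : u ∈ S <;> by_cases hw : w ∈ T <;> simp [hu, hw]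
    rw [h1]
    simp only [link, add_mul, ite_and]
    congr 1
    · by_cases hu : u = σ.s j
      · by_cases hw : w = σ.x j
        · simp [hu, hw]
        · simp [hw]
      · simp [hu]
    · by_cases hu : u = σ.t j
      · by_cases hw : w = σ.y j
        · simp [hu, hw]
        · simp [hw]
      · simp [hu]
  simp only [key, Finset.sum_add_distrib]
  congr 1
  · rw [Finset.sum_eq_single (σ.s j) (by intro x _ hx; simp [hx]) (by simp)]
    rw [Finset.sum_eq_single (σ.x j) (by intro x _ hx; simp [hx]) (by simp)]
    simp
  · rw [Finset.sum_eq_single (σ.t j) (by intro x _ hx; simp [hx]) (by simp)]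
    rw [Finset.sum_eq_single (σ.y j) (by intro x _ hx; simp [hx]) (by simp)]
    simp

theorem cutSize_graph (σ : Substitution B J W) (X : Finset (B ⊕ Σ j, W j)) :
    σ.graph.cutSize X = σ.base.cutSize (basePart X) + ∑ j, σ.pieceCut X j := by
  classical
  simp only [pieceCut, cutSize_eq_sum, Fintype.sum_sum_type, Finset.sum_add_distrib, add_assoc]
  rw [← Finset.sum_add_distrib (f := fun j => sep (σ.s j ∈ basePart X) (σ.x j ∈ piecePart X j))]
  simp only [← sum_link_cut, Finset.sum_add_distrib]
  simp only [mem_basePart, mem_piecePart, Fintype.sum_sigma]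
  have h1 : ∀ (j : J) (w : W j), (∑ i, ∑ v : W i, if Sum.inr ⟨j, w⟩ ∈ X ∧ Sum.inr ⟨i, v⟩ ∉ X
      then σ.graph.mult (Sum.inr ⟨j, w⟩) (Sum.inr ⟨i, v⟩) else 0) =
      ∑ v, if Sum.inr ⟨j, w⟩ ∈ X ∧ Sum.inr ⟨j, v⟩ ∉ X then (σ.piece j).mult w v else 0 := by
    intro j w
    have := σ.sum_inner (fun q n => if Sum.inr ⟨j, w⟩ ∈ X ∧ Sum.inr q ∉ X then n else 0)
      (by simp) j w
    rw [Fintype.sum_sigma] at this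
    exact this
  have comb : ∀ {a b c d a' b' c' d' : ℕ}, a = a' → b = d' → c = c' → d = b' →
      a + (b + (c + d)) = a' + (b' + (c' + d')) := by intros; omega
  refine comb ?_ ?_ ?_ ?_
  · exact Finset.sum_congr rfl fun u _ => Finset.sum_congr rfl fun v _ => by congr
  · exact Finset.sum_congr rfl fun j _ => Finset.sum_congr rfl fun w _ =>
      Finset.sum_congr rfl fun v _ => by congr
  · rw [Finset.sum_comm]
    exact Finset.sum_congr rfl fun j _ => Finset.sum_congr rfl fun w _ =>
      Finset.sum_congr rfl fun v _ => by congr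
  · refine Finset.sum_congr rfl fun j _ => Finset.sum_congr rfl fun w _ => ?_
    convert h1 j w

/-- If `X` meets some piece in an odd set, the cut of `K j` there has at least `r` edges, of which
only `x j – y j` may be missing, and parity restores it. Otherwise `X` meets the base in an odd set,
and it suffices that each edge `s j – t j` cut in `H` is still paid for: if neither link to the
piece is cut, then `x j` and `y j` are separated, and the even cut of `K j` contains a second edge
besides `x j – y j`. -/
theorem Replaces.isRGraph (hσ : σ.Replaces H K) (hr : Odd r) (hH : H.IsRGraph r)
    (hK : ∀ j, (K j).IsRGraph r) : σ.graph.IsRGraph r := by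
  have hreg := hσ.isRegular hH.1 fun j => (hK j).1
  refine ⟨hreg, fun X hX => ?_⟩
  have hKcut := fun j => cutSize_add_edge (K j) (σ.piece j) (hσ.x_ne_y j) (hσ.piece_eq j)
    (piecePart X j)
  have hcut := σ.cutSize_graph X
  by_cases hodd : ∃ j, Odd (piecePart X j).card
  · obtain ⟨j, hj⟩ := hodd
    refine hreg.le_cutSize_of_odd hr hX ?_
    have h1 := (hK j).2 _ hj
    have h2 := hKcut j
    have h3 : σ.pieceCut X j ≤ ∑ j, σ.pieceCut X j :=
      Finset.single_le_sum (f := fun j => σ.pieceCut X j) (fun _ _ => Nat.zero_le _)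
        (Finset.mem_univ j)
    have h4 : sep (σ.x j ∈ piecePart X j) (σ.y j ∈ piecePart X j) ≤ 1 := by
      unfold sep; split_ifs <;> simp
    rw [pieceCut] at h3
    omega
  · push Not at hodd
    have hbase : Odd (basePart X).card := by
      rw [card_eq_parts, Nat.odd_add] at hX
      rw [hX]
      exact Finset.even_sum _ fun j _ => by simpa using hodd j
    refine (hH.2 _ hbase).trans ?_
    rw [cutSize_add_edges H σ.base σ.s σ.t hσ.s_ne_t hσ.base_eq, hcut]
    refine Nat.add_le_add_left (Finset.sum_le_sum fun j _ => ?_) _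
    have h2 := hKcut j
    have hev : Even ((K j).cutSize (piecePart X j)) := by
      rw [(hK j).1.even_cutSize]
      exact Even.mul_right (by simpa using hodd j) _
    rw [h2] at hev
    unfold pieceCut
    unfold sep at hev ⊢
    by_cases h3 : σ.s j ∈ basePart X <;> by_cases h4 : σ.t j ∈ basePart X <;>
      by_cases h5 : σ.x j ∈ piecePart X j <;> by_cases h6 : σ.y j ∈ piecePart X j <;>
      simp [h3, h4, h5, h6] at hev ⊢
    all_goals
      obtain ⟨k, hk⟩ := hev
      omega

end Substitution
end Multigraph

/-! ### Undoing substitutions by 2-cut reductions -/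

namespace Multigraph

theorem cutSize_map {V W : Type*} [Fintype V] [Fintype W] {G : Multigraph V} {H : Multigraph W}
    (e : V ≃ W) (he : ∀ x y, H.mult (e x) (e y) = G.mult x y) (S : Finset V) :
    H.cutSize (S.map e.toEmbedding) = G.cutSize S := by
  classical
  simp only [cutSize_eq_sum]
  rw [← e.sum_comp]
  refine Finset.sum_congr rfl fun x _ => ?_
  rw [← e.sum_comp]
  refine Finset.sum_congr rfl fun y _ => ?_
  simp [he]

theorem IsRGraph.of_equiv {V W : Type*} [Fintype V] [Fintype W] {G : Multigraph V}
    {H : Multigraph W} {r : ℕ} (e : V ≃ W) (he : ∀ x y, H.mult (e x) (e y) = G.mult x y)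
    (hG : G.IsRGraph r) : H.IsRGraph r := by
  constructor
  · intro w
    obtain ⟨v, rfl⟩ := e.surjective w
    rw [← hG.1 v, degree, degree, ← e.sum_comp]
    simp [he]
  · intro S hS
    obtain ⟨T, rfl⟩ : ∃ T : Finset V, T.map e.toEmbedding = S :=
      ⟨S.map e.symm.toEmbedding, by ext; simp⟩
    rw [cutSize_map e he]
    exact hG.2 T (by simpa using hS)

/-- A reduction produces a graph on a subtype, whereas the graphs built here live on sum types; this
transports a whole chain of reductions between the two. -/
theorem IsObtainedFrom.of_iso {W : Type u} {H : Multigraph W} {r : ℕ} {V : Type u}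
    {G : Multigraph V} (h : H.IsObtainedFrom r G) :
    ∀ {V' : Type u} (G' : Multigraph V'), G.IsIsomorphic G' → H.IsObtainedFrom r G' := by
  classical
  induction h with
  | iso G h =>
    rintro V' G' ⟨e, he⟩
    obtain ⟨f, hf⟩ := h
    refine .iso G' ⟨e.symm.trans f, fun x y => ?_⟩
    rw [Equiv.trans_apply, Equiv.trans_apply, hf, ← he]
    simp
  | @reduction V _ G hG S u v huv hS hcut hN h ih =>
    rintro V' G' ⟨e, he⟩
    let _ : Fintype V' := Fintype.ofEquiv V e
    have huv' : e u ≠ e v := fun h => huv (e.injective h)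
    refine .reduction G' (hG.of_equiv e he) (S.map e.toEmbedding) (e u) (e v) huv' (by simpa)
      (by rw [cutSize_map e he, hcut]) ?_ (ih _ ⟨e.subtypeEquiv (by simp), fun x y => ?_⟩)
    · ext w
      obtain ⟨z, rfl⟩ := e.surjective w
      have := Set.ext_iff.1 hN z
      simp only [neighborSet, Set.mem_ofPred_eq, Set.mem_insert_iff, Set.mem_singleton_iff] at this
      rw [Set.mem_insert_iff, Set.mem_singleton_iff, e.apply_eq_iff_eq, e.apply_eq_iff_eq, ← this]
      refine and_congr (by simp) ⟨?_, ?_⟩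
      · rintro ⟨x, hx, hp⟩
        obtain ⟨x, rfl⟩ := e.surjective x
        exact ⟨x, by simpa using hx, by rwa [he] at hp⟩
      · rintro ⟨x, hx, hp⟩
        exact ⟨e x, by simpa using hx, by rwa [he]⟩
    · simp [deleteAddEdge, he]

/-- One reduction in usable form: the remaining vertices are described by an injection `f` onto the
complement of `S`. The evenness of `S` is automatic, since the cut has size 2 and `r` is odd. -/
theorem IsObtainedFrom.of_deletion {W V Z : Type u} [Fintype V] {H : Multigraph W} {r : ℕ}
    {G : Multigraph V} {K : Multigraph Z} (h : H.IsObtainedFrom r K) (hr : Odd r)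
    (hG : G.IsRGraph r) {S : Finset V} {u v : V} (huv : u ≠ v) (hcut : G.cutSize S = 2)
    (hN : G.neighborSet S = {u, v}) (f : Z → V) (hf : Function.Injective f)
    (hS : ∀ x, x ∉ S ↔ ∃ z, f z = x)
    (hK : ∀ y z, K.mult y z = G.mult (f y) (f z) + edgeCount u v (f y) (f z)) :
    H.IsObtainedFrom r G := by
  refine .reduction G hG S u v huv (hG.1.even_card_of_even_cutSize hr (by rw [hcut]; decide))
    hcut hN (h.of_iso _ ⟨Equiv.ofBijective (fun z => ⟨f z, (hS _).2 ⟨z, rfl⟩⟩) ⟨?_, ?_⟩, ?_⟩)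
  · intro y z hyz
    exact hf (congrArg Subtype.val hyz)
  · rintro ⟨x, hx⟩
    obtain ⟨z, rfl⟩ := (hS x).1 hx
    exact ⟨z, rfl⟩
  · intro y z
    rw [hK]
    rfl

namespace Substitution

variable {B J : Type*} {W : J → Type*}

/-- The vertices of the piece with index `j`. -/
noncomputable def copy (B : Type*) {J : Type*} (W : J → Type*) (j : J) [Fintype (W j)] :
    Finset (B ⊕ Σ j, W j) := by
  classical exact Finset.univ.image fun w : W j => Sum.inr ⟨j, w⟩

theorem inl_notMem_copy [∀ j, Fintype (W j)] (u : B) (j : J) : Sum.inl u ∉ copy B W j := by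
  simp [copy]

theorem inr_mem_copy [∀ j, Fintype (W j)] {p : Σ j, W j} {j : J} :
    Sum.inr p ∈ copy B W j ↔ p.1 = j := by
  obtain ⟨i, v⟩ := p
  simp only [copy, Finset.mem_image, Finset.mem_univ, true_and, Sum.inr.injEq]
  constructor
  · rintro ⟨w, h⟩
    exact (congrArg Sigma.fst h).symm
  · rintro rfl
    exact ⟨v, rfl⟩

theorem link_pos {σ : Substitution B J W} {u : B} {q : Σ j, W j} :
    0 < σ.link u q ↔ (u = σ.s q.1 ∧ q.2 = σ.x q.1) ∨ (u = σ.t q.1 ∧ q.2 = σ.y q.1) := by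
  classical
  unfold link
  by_cases h1 : u = σ.s q.1 ∧ q.2 = σ.x q.1 <;> by_cases h2 : u = σ.t q.1 ∧ q.2 = σ.y q.1 <;>
    simp [h1, h2]

theorem link_le_one {σ : Substitution B J W} {u : B} {q : Σ j, W j}
    (h : σ.x q.1 ≠ σ.y q.1) : σ.link u q ≤ 1 := by
  classical
  unfold link
  by_cases h1 : q.2 = σ.x q.1
  · have : ¬ (q.2 = σ.y q.1) := fun h2 => h (h1.symm.trans h2)
    simp only [this, and_false, if_false, add_zero]
    split_ifs <;> simp
  · simp only [h1, and_false, if_false, zero_add]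
    split_ifs <;> simp

theorem link_congr {σ : Substitution B J W} {u u' : B} {q q' : Σ j, W j}
    (h1 : u = σ.s q.1 ∧ q.2 = σ.x q.1 ↔ u' = σ.s q'.1 ∧ q'.2 = σ.x q'.1)
    (h2 : u = σ.t q.1 ∧ q.2 = σ.y q.1 ↔ u' = σ.t q'.1 ∧ q'.2 = σ.y q'.1) :
    σ.link u q = σ.link u' q' := by
  classical
  simp only [link, h1, h2]

variable [Fintype J] [Fintype B] [∀ j, Fintype (W j)]

theorem cutSize_copy (σ : Substitution B J W) (j : J) : σ.graph.cutSize (copy B W j) = 2 := by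
  classical
  rw [cutSize_graph]
  have h1 : basePart (copy B W j) = ∅ := by
    ext u; simp [mem_basePart, inl_notMem_copy]
  have h2 : ∀ i, piecePart (copy B W j) i = if i = j then Finset.univ else ∅ := by
    intro i
    ext w
    simp only [mem_piecePart, inr_mem_copy]
    split_ifs with h <;> simp [h]
  have h3 : σ.base.cutSize ∅ = 0 := by simp [cutSize]
  rw [h1, h3, zero_add, Finset.sum_eq_single j]
  · simp [pieceCut, h1, h2, sep, cutSize]
  · intro i _ hi
    simp [pieceCut, h1, h2, sep, cutSize, hi]
  · simp

theorem neighborSet_copy (σ : Substitution B J W) (j : J) :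
    σ.graph.neighborSet (copy B W j) = {Sum.inl (σ.s j), Sum.inl (σ.t j)} := by
  ext v
  simp only [neighborSet, Set.mem_ofPred_eq, Set.mem_insert_iff, Set.mem_singleton_iff]
  constructor
  · rintro ⟨hv, x, hx, hpos⟩
    rcases x with u | ⟨i, w⟩
    · exact absurd hx (inl_notMem_copy u j)
    obtain rfl : i = j := inr_mem_copy.1 hx
    rcases v with v | q
    · have : 0 < σ.link v ⟨i, w⟩ := hpos
      rw [link_pos] at this
      rcases this with h | h
      · exact Or.inl (congrArg _ h.1)
      · exact Or.inr (congrArg _ h.1)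
    · exfalso
      rw [inr_mem_copy] at hv
      have : σ.inner ⟨i, w⟩ q = 0 := inner_of_ne _ (Ne.symm hv)
      exact absurd (this ▸ hpos : 0 < 0) (lt_irrefl 0)
  · rintro (rfl | rfl)
    · exact ⟨inl_notMem_copy _ _, Sum.inr ⟨j, σ.x j⟩, inr_mem_copy.2 rfl,
        link_pos.2 (Or.inl ⟨rfl, rfl⟩)⟩
    · exact ⟨inl_notMem_copy _ _, Sum.inr ⟨j, σ.y j⟩, inr_mem_copy.2 rfl,
        link_pos.2 (Or.inr ⟨rfl, rfl⟩)⟩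

open scoped Classical in
theorem neighborSet_compl_copy (σ : Substitution B J W) (j : J) :
    σ.graph.neighborSet (copy B W j)ᶜ = {Sum.inr ⟨j, σ.x j⟩, Sum.inr ⟨j, σ.y j⟩} := by
  ext v
  simp only [neighborSet, Set.mem_ofPred_eq, Set.mem_insert_iff, Set.mem_singleton_iff,
    Finset.mem_compl, not_not]
  constructor
  · rintro ⟨hv, x, hx, hpos⟩
    rcases v with v | ⟨i, w⟩
    · exact absurd hv (inl_notMem_copy v j)
    obtain rfl : i = j := inr_mem_copy.1 hv
    rcases x with u | q
    · have : 0 < σ.link u ⟨i, w⟩ := hpos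
      rw [link_pos] at this
      rcases this with ⟨_, h⟩ | ⟨_, h⟩
      · left; simpa using h
      · right; simpa using h
    · exfalso
      rw [inr_mem_copy] at hx
      have : σ.inner q ⟨i, w⟩ = 0 := inner_of_ne _ hx
      exact absurd (this ▸ hpos : 0 < 0) (lt_irrefl 0)
  · rintro (rfl | rfl)
    · exact ⟨inr_mem_copy.2 rfl, Sum.inl (σ.s j), inl_notMem_copy _ _,
        link_pos.2 (Or.inl ⟨rfl, rfl⟩)⟩
    · exact ⟨inr_mem_copy.2 rfl, Sum.inl (σ.t j), inl_notMem_copy _ _,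
        link_pos.2 (Or.inr ⟨rfl, rfl⟩)⟩

end Substitution

open Substitution

/-- The deleted set is the complement of one copy. Its neighbours are `x j` and `y j`, so the new
edge is exactly the one removed from `K j`. -/
theorem Substitution.Replaces.isObtainedFrom_piece {B J : Type} {W : J → Type u}
    [Fintype J] [Fintype B] [∀ j, Fintype (W j)] {σ : Substitution B J W} {H : Multigraph B}
    {K : ∀ j, Multigraph (W j)} {r : ℕ} (hσ : σ.Replaces H K) (hr : Odd r)
    (hG : σ.graph.IsRGraph r) (j : J) {Z : Type u} {L : Multigraph Z}
    (h : L.IsObtainedFrom r (K j)) : L.IsObtainedFrom r σ.graph := by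
  classical
  have hne : (Sum.inr ⟨j, σ.x j⟩ : B ⊕ Σ j, W j) ≠ Sum.inr ⟨j, σ.y j⟩ := by
    simpa using hσ.x_ne_y j
  refine h.of_deletion hr hG hne ((cutSize_compl _ _).trans (σ.cutSize_copy j))
    (σ.neighborSet_compl_copy j) (fun w => .inr ⟨j, w⟩) ?_ ?_ ?_
  · intro v w hvw
    simpa using hvw
  · rintro (u | ⟨i, w⟩)
    · simp [inl_notMem_copy]
    · simp only [Finset.mem_compl, not_not, inr_mem_copy]
      constructor
      · rintro rfl
        exact ⟨w, rfl⟩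
      · rintro ⟨z, hz⟩
        exact (congrArg Sigma.fst (Sum.inr.inj hz)).symm
  · intro v w
    rw [hσ.piece_eq, graph_inr_inr, σ.inner_same]
    simp [edgeCount]

/-- The pieces are deleted one at a time; each reduction returns the edge `s j – t j` to the base
and leaves a substitution over one index fewer. -/
theorem Substitution.Replaces.isObtainedFrom_base {B J : Type u} {W : J → Type}
    [Fintype J] [Fintype B] [∀ j, Fintype (W j)] {σ : Substitution B J W} {H : Multigraph B}
    {K : ∀ j, Multigraph (W j)} {r : ℕ} (hσ : σ.Replaces H K) (hr : Odd r)
    (hH : H.IsRGraph r) (hK : ∀ j, (K j).IsRGraph r) : H.IsObtainedFrom r σ.graph := by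
  classical
  obtain ⟨n, hn⟩ : ∃ n, Fintype.card J = n := ⟨_, rfl⟩
  induction n generalizing J with
  | zero =>
    have : IsEmpty J := Fintype.card_eq_zero_iff.1 hn
    refine .iso _ ⟨Equiv.sumEmpty B _, ?_⟩
    rintro (u | ⟨j, _⟩) (v | ⟨i, _⟩)
    · simp [hσ.base_eq, graph_inl_inl]
    · exact (this.false i).elim
    · exact (this.false j).elim
    · exact (this.false j).elim
  | succ n ih =>
    obtain ⟨j⟩ : Nonempty J := Fintype.card_pos_iff.1 (by omega)
    let σ' : Substitution B {i : J // i ≠ j} (fun i => W i) :=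
      { base :=
          { mult := fun u v => σ.base.mult u v + edgeCount (σ.s j) (σ.t j) u v
            mult_comm := fun u v => by rw [mult_comm, edgeCount_comm]
            mult_self := fun u => by rw [mult_self, edgeCount_self (hσ.s_ne_t j)] }
        s := fun i => σ.s i
        t := fun i => σ.t i
        piece := fun i => σ.piece i
        x := fun i => σ.x i
        y := fun i => σ.y i }
    have hσ' : σ'.Replaces H (fun i => K i) :=
      { s_ne_t := fun i => hσ.s_ne_t i
        x_ne_y := fun i => hσ.x_ne_y i
        base_eq := fun u v => by
          rw [hσ.base_eq, Fintype.sum_eq_add_sum_subtype_ne _ j, ← add_assoc]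
        piece_eq := fun i => hσ.piece_eq i }
    have h := ih hσ' (fun i => hK i) (by
      rw [Fintype.card_subtype_compl, hn]; simp)
    have hne : (Sum.inl (σ.s j) : B ⊕ Σ j, W j) ≠ Sum.inl (σ.t j) := by
      simpa using hσ.s_ne_t j
    refine h.of_deletion hr (hσ.isRGraph hr hH hK) hne (σ.cutSize_copy j) (σ.neighborSet_copy j)
      (Sum.map id fun q => ⟨q.1, q.2⟩) ?_ ?_ ?_
    · refine Function.Injective.sumMap Function.injective_id ?_
      rintro ⟨⟨i, hi⟩, w⟩ ⟨⟨k, hk⟩, z⟩ h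
      simp only [Sigma.mk.injEq] at h
      obtain ⟨rfl, h⟩ := h
      rw [eq_of_heq h]
    · rintro (u | ⟨i, w⟩)
      · exact ⟨fun _ => ⟨.inl u, rfl⟩, fun _ => inl_notMem_copy u j⟩
      · rw [inr_mem_copy]
        refine ⟨fun h => ⟨.inr ⟨⟨i, h⟩, w⟩, rfl⟩, ?_⟩
        rintro ⟨u | ⟨k, z⟩, h⟩
        · simp at h
        · simp only [Sum.map_inr, Sum.inr.injEq] at h
          have := congrArg Sigma.fst h
          exact this ▸ k.2
    · rintro (u | ⟨⟨i, hi⟩, w⟩) (v | ⟨⟨k, hk⟩, z⟩)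
      · simp [graph_inl_inl, σ', edgeCount]
      · simp [graph_inl_inr, σ', edgeCount, link]
      · simp [graph_inr_inl, σ', edgeCount, link]
      · simp only [graph_inr_inr, Sum.map_inr]
        by_cases hik : i = k
        · subst hik
          rw [inner_same, inner_same]
          simp [σ', edgeCount]
        · rw [inner_of_ne _ (by simpa using hik), inner_of_ne _ (by simpa using hik)]
          simp [edgeCount]

end Multigraph

/-! ### Rooted forests -/

/-- A rooted forest, given by the parent of each vertex that is not a root and by the depth. -/
structure RootedForest (V : Type*) where
  par : V → Option V
  dep : V → ℕ
  dep_par : ∀ {v u}, par v = some u → dep v = dep u + 1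

namespace RootedForest
open Multigraph

variable {V : Type*} (F : RootedForest V)

theorem par_ne_self (v : V) : F.par v ≠ some v := fun h => by
  have := F.dep_par h
  omega

theorem not_par_par {u v : V} (h : F.par u = some v) : F.par v ≠ some u := fun h' => by
  have := F.dep_par h
  have := F.dep_par h'
  omega

open scoped Classical in
/-- The graph that joins each vertex to its parent. -/
noncomputable def graph : Multigraph V where
  mult u v := (if F.par u = some v then 1 else 0) + (if F.par v = some u then 1 else 0)
  mult_comm u v := add_comm _ _
  mult_self v := by simp [F.par_ne_self v]

theorem graph_pos {u v : V} : 0 < F.graph.mult u v ↔ F.par u = some v ∨ F.par v = some u := by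
  classical
  simp only [graph]
  by_cases h : F.par u = some v <;> by_cases h' : F.par v = some u <;> simp [h, h']

theorem graph_le_one (u v : V) : F.graph.mult u v ≤ 1 := by
  classical
  simp only [graph]
  by_cases h : F.par u = some v
  · simp [h, F.not_par_par h]
  · simp only [h, if_false, zero_add]
    split_ifs <;> simp

/-- A forest on `S` has at most `|S| - 1` edges: charge each edge to its child. A vertex of least
depth in `S` has no parent in `S`. -/
theorem sum_graph_le (S : Finset V) (hS : S.Nonempty) :
    (∑ u ∈ S, ∑ v ∈ S, F.graph.mult u v) + 2 ≤ 2 * S.card := by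
  classical
  have h1 : (∑ u ∈ S, ∑ v ∈ S, if F.par u = some v then 1 else 0) + 1 ≤ S.card := by
    obtain ⟨u₀, hu₀, hmin⟩ := S.exists_min_image F.dep hS
    rw [← Finset.add_sum_erase _ _ hu₀, ← Finset.card_erase_add_one hu₀]
    have h0 : (∑ v ∈ S, if F.par u₀ = some v then 1 else 0) = 0 := by
      refine Finset.sum_eq_zero fun v hv => if_neg fun h => ?_
      have := F.dep_par h
      have := hmin v hv
      omega
    rw [h0, zero_add]
    refine Nat.add_le_add_right ?_ 1
    rw [Finset.card_eq_sum_ones]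
    refine Finset.sum_le_sum fun u _ => ?_
    cases hp : F.par u with
    | none => simp
    | some w =>
      simp only [Option.some.injEq]
      rw [Finset.sum_ite_eq]
      split_ifs <;> simp
  simp only [graph, Finset.sum_add_distrib]
  rw [Finset.sum_comm (f := fun u v => if F.par v = some u then 1 else 0)]
  omega

open scoped Classical in
theorem degree_graph [Fintype V] (v : V) :
    F.graph.degree v = (if F.par v = none then 0 else 1) +
      (Finset.univ.filter fun u => F.par u = some v).card := by
  simp only [degree, graph, Finset.sum_add_distrib, Finset.card_filter]
  congr 1
  cases hp : F.par v with
  | none => simp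
  | some w => simp

/-- A forest with full inner degrees together with a highly connected graph on the leaves is an
`r`-graph. -/
theorem isRGraph_of_leaves [Fintype V] {r : ℕ} (hr : Odd r) (hr2 : 2 ≤ r) {K R : Multigraph V}
    (hreg : K.IsRegular r) (hK : ∀ u v, K.mult u v = F.graph.mult u v + R.mult u v)
    (L : Set V) (hR : ∀ u v, u ∉ L → R.mult u v = 0)
    (hcut : ∀ S : Finset V, (∃ v ∈ S, v ∈ L) → (∃ v ∈ L, v ∉ S) → r ≤ R.cutSize S + 1) :
    K.IsRGraph r := by
  classical
  have hinner : ∀ S : Finset V, Odd S.card → (∀ v ∈ S, v ∉ L) → r ≤ K.cutSize S := by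
    intro S hS hL
    have hne : S.Nonempty := Finset.card_pos.1 hS.pos
    have h1 := sum_degree_eq K S
    rw [Finset.sum_congr rfl (fun x _ => hreg x), Finset.sum_const, smul_eq_mul] at h1
    have h2 : ∑ u ∈ S, ∑ v ∈ S, K.mult u v = ∑ u ∈ S, ∑ v ∈ S, F.graph.mult u v :=
      Finset.sum_congr rfl fun u hu => Finset.sum_congr rfl fun v _ => by
        rw [hK, hR u v (hL u hu), add_zero]
    have h3 := F.sum_graph_le S hne
    have h4 := Finset.card_pos.2 hne
    rw [h2] at h1
    -- With `|S| = c + 1` and `r = d + 2`, the cut has at least `(c + 1)(d + 2) - 2c = cd + d + 2 ≥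
    -- r` edges.
    obtain ⟨c, hc⟩ := Nat.exists_eq_add_of_lt h4
    obtain ⟨d, hd⟩ := Nat.exists_eq_add_of_le hr2
    rw [hc] at h1 h3
    subst hd
    have h5 : (0 + c + 1) * (2 + d) = 2 * c + c * d + 2 + d := by ring
    rw [h5] at h1
    have := Nat.zero_le (c * d)
    omega
  refine ⟨hreg, fun S hS => ?_⟩
  by_cases h1 : ∃ v ∈ S, v ∈ L
  · by_cases h2 : ∃ v ∈ L, v ∉ S
    · refine hreg.le_cutSize_of_odd hr hS ((hcut S h1 h2).trans ?_)
      refine Nat.add_le_add_right ?_ 1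
      unfold cutSize
      exact Finset.sum_le_sum fun u _ => Finset.sum_le_sum fun v _ => by rw [hK]; omega
    · push Not at h2
      -- All of `L` lies in `S`, so the complement has no vertex in `L`; it is odd because the order
      -- of the graph is even.
      rw [← cutSize_compl]
      refine hinner _ ?_ fun v hv hL => Finset.mem_compl.1 hv (h2 v hL)
      rw [Finset.card_compl]
      have := hreg.even_card hr
      exact Nat.Even.sub_odd (Finset.card_le_univ S) this hS
  · push Not at h1
    exact hinner S hS h1

/-! ### Spanning trees -/

/-- The simple graph that joins each vertex to its parent. -/
def tree : SimpleGraph V where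
  Adj u v := F.par u = some v ∨ F.par v = some u
  symm := ⟨fun _ _ h => h.symm⟩
  loopless := ⟨fun v h => h.elim (F.par_ne_self v) (F.par_ne_self v)⟩

variable {F}

theorem reachable_root {v₀ : V} (hroot : ∀ v, F.par v = none → v = v₀) (v : V) :
    F.tree.Reachable v₀ v := by
  induction h : F.dep v generalizing v with
  | zero =>
    cases hp : F.par v with
    | none => rw [hroot v hp]
    | some u => have := F.dep_par hp; omega
  | succ n ih =>
    cases hp : F.par v with
    | none => rw [hroot v hp]
    | some u =>
      have := F.dep_par hp
      exact (ih u (by omega)).trans (SimpleGraph.Adj.reachable (Or.inr hp))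

/-- Every edge joins a vertex other than the root to its parent, so there are at most `n - 1` edges;
a connected graph with so few edges is a tree. -/
theorem isTree [Fintype V] {v₀ : V} (hroot : ∀ v, F.par v = none ↔ v = v₀) : F.tree.IsTree := by
  classical
  have hconn : F.tree.Connected :=
    { preconnected := fun u v => (reachable_root (fun v => (hroot v).1) u).symm.trans
        (reachable_root (fun v => (hroot v).1) v)
      nonempty := ⟨v₀⟩ }
  rw [SimpleGraph.isTree_iff_connected_and_card]
  refine ⟨hconn, le_antisymm ?_ hconn.card_vert_le_card_edgeSet_add_one⟩
  have hp : ∀ v : {v : V // v ≠ v₀}, ∃ u, F.par v = some u := fun v =>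
    Option.ne_none_iff_exists'.1 fun h => v.2 ((hroot _).1 h)
  choose p hp using hp
  have hle : Nat.card F.tree.edgeSet ≤ Nat.card {v : V // v ≠ v₀} := by
    refine Nat.card_le_card_of_surjective
      (fun v => ⟨s(v.1, p v), SimpleGraph.mem_edgeSet _ |>.2 (Or.inl (hp v))⟩) ?_
    rintro ⟨e, he⟩
    induction e using Sym2.ind with
    | _ u v =>
      have hne : ∀ {u v}, F.par u = some v → u ≠ v₀ := fun h hu => by
        rw [(hroot _).2 hu] at h; cases h
      rcases (SimpleGraph.mem_edgeSet _).1 he with h | h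
      · have := Option.some.inj ((hp ⟨u, hne h⟩).symm.trans h)
        exact ⟨⟨u, hne h⟩, by simp [this]⟩
      · have := Option.some.inj ((hp ⟨v, hne h⟩).symm.trans h)
        exact ⟨⟨v, hne h⟩, by simp [this, Sym2.eq_swap]⟩
  have hcard : Nat.card {v : V // v ≠ v₀} + 1 = Nat.card V := by
    rw [Nat.card_eq_fintype_card, Nat.card_eq_fintype_card, Fintype.card_subtype_compl]
    have : 0 < Fintype.card V := Fintype.card_pos_iff.2 ⟨v₀⟩
    simp; omega
  omega

/-- Following parents gives the upper bound. For the lower bound, depth increases by at most one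
along any edge of a walk. -/
theorem dist_root {v₀ : V} (hroot : ∀ v, F.par v = none → v = v₀) (h0 : F.dep v₀ = 0) (v : V) :
    F.tree.dist v₀ v = F.dep v := by
  apply le_antisymm
  · induction h : F.dep v generalizing v with
    | zero =>
      cases hp : F.par v with
      | none => rw [hroot v hp]; simp
      | some u => have := F.dep_par hp; omega
    | succ n ih =>
      cases hp : F.par v with
      | none => rw [hroot v hp]; simp
      | some u =>
        have := F.dep_par hp
        obtain ⟨w, hw⟩ := (reachable_root hroot u).exists_walk_length_eq_dist
        have h1 := ih u (by omega)
        have h2 := SimpleGraph.dist_le (w.concat (show F.tree.Adj u v from Or.inr hp))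
        rw [SimpleGraph.Walk.length_concat] at h2
        omega
  · obtain ⟨w, hw⟩ := (reachable_root hroot v).exists_walk_length_eq_dist
    rw [← hw]
    have : ∀ {a b : V} (w : F.tree.Walk a b), F.dep b ≤ F.dep a + w.length := by
      intro a b w
      induction w with
      | nil => simp
      | cons h w ih =>
        rw [SimpleGraph.Walk.length_cons]
        rcases h with h | h
        · have := F.dep_par h
          omega
        · have := F.dep_par h
          omega
    have := this w
    omega

/-- A graph is *trimmed* with respect to a forest and a number `D` if it is simple, contains the
forest, and every vertex is either a leaf of depth `D` or has only edges of the forest. -/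
structure IsTrimmed (F : RootedForest V) (N : Multigraph V) (D : ℕ) : Prop where
  simple : N.IsSimple
  par_adj : ∀ {u v}, F.par u = some v → 0 < N.mult u v
  good : ∀ v, ((∀ u, F.par u ≠ some v) ∧ F.dep v = D) ∨
    ∀ u, 0 < N.mult v u → F.par v = some u ∨ F.par u = some v

/-- A vertex all of whose edges lie in the tree keeps its full degree `r`, since the graph is
simple; every other vertex is a leaf of depth `D`. For `r = 1` the degree does not tell the two
kinds apart, so the depths are then assumed. -/
theorem IsTrimmed.isRootedTree [Fintype V] {G : Multigraph V} {D r : ℕ} (h : F.IsTrimmed G D)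
    (hreg : G.IsRegular r) {v₀ : V} (hr : r = 1 → ∀ v, v ≠ v₀ → F.dep v = D)
    (hroot : ∀ v, F.par v = none ↔ v = v₀)
    (h0 : F.dep v₀ = 0) (hD : D ≠ 0) : IsRootedTree F.tree r D v₀ := by
  classical
  have hleaf : ∀ v, v ≠ v₀ → (∀ u, F.par u ≠ some v) → F.tree.degree v = 1 := by
    intro v hv hu
    obtain ⟨p, hp⟩ := Option.ne_none_iff_exists'.1 fun h => hv ((hroot _).1 h)
    rw [← SimpleGraph.card_neighborFinset_eq_degree, Finset.card_eq_one]
    refine ⟨p, ?_⟩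
    ext w
    rw [SimpleGraph.mem_neighborFinset, Finset.mem_singleton]
    constructor
    · rintro (h | h)
      · rw [hp] at h; exact (Option.some.inj h).symm
      · exact absurd h (hu w)
    · rintro rfl
      exact Or.inl hp
  have hinner : ∀ v, (∀ u, 0 < G.mult v u → F.par v = some u ∨ F.par u = some v) →
      F.tree.degree v = r := by
    intro v hv
    rw [← hreg v, degree, ← SimpleGraph.card_neighborFinset_eq_degree, Finset.card_eq_sum_ones]
    rw [← Finset.sum_subset (Finset.subset_univ (F.tree.neighborFinset v))]
    · refine Finset.sum_congr rfl fun u hu => ?_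
      rw [SimpleGraph.mem_neighborFinset] at hu
      have h1 : 0 < G.mult v u := by
        rcases hu with hu | hu
        · exact h.par_adj hu
        · rw [G.mult_comm]; exact h.par_adj hu
      have := h.simple v u
      omega
    · intro u _ hu
      rw [SimpleGraph.mem_neighborFinset] at hu
      by_contra hne
      exact hu (hv u (Nat.pos_of_ne_zero hne))
  have hv₀ : ∀ v, ((∀ u, F.par u ≠ some v) ∧ F.dep v = D) → v ≠ v₀ := by
    rintro v ⟨-, hv⟩ rfl
    exact hD (hv.symm.trans h0)
  refine ⟨isTree hroot, fun v => ?_, ?_, fun v hv hdeg => ?_⟩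
  · rcases h.good v with hv | hv
    · left
      convert hleaf v (hv₀ v hv) hv.1
    · right
      convert hinner v hv
  · rcases h.good v₀ with hv | hv
    · exact absurd rfl (hv₀ v₀ hv)
    · convert hinner v₀ hv
  · rw [dist_root (fun v => (hroot v).1) h0]
    rcases h.good v with hv' | hv'
    · exact hv'.2
    · refine hr ?_ v hv
      rw [← hdeg]
      symm
      convert hinner v hv'

theorem IsTrimmed.tree_le {G : Multigraph V} {D : ℕ} (h : F.IsTrimmed G D) :
    F.tree ≤ G.toSimpleGraph := by
  rintro u v (hu | hu)
  · exact h.par_adj hu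
  · exact G.toSimpleGraph.symm.symm _ _ (h.par_adj hu)

end RootedForest

/-! ### Circulant graphs and their edge connectivity -/

namespace Multigraph

/-- The offsets `±1, …, ±h` modulo `N`. -/
noncomputable def offsets (N h : ℕ) : Finset (ZMod N) :=
  ((Finset.Icc (-(h : ℤ)) h).erase 0).image (fun k : ℤ => (k : ZMod N))

theorem mem_offsets {N h : ℕ} {d : ZMod N} :
    d ∈ offsets N h ↔ ∃ k : ℤ, -(h : ℤ) ≤ k ∧ k ≤ h ∧ k ≠ 0 ∧ (k : ZMod N) = d := by
  simp only [offsets, Finset.mem_image, Finset.mem_erase, Finset.mem_Icc]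
  constructor
  · rintro ⟨k, ⟨h1, h2, h3⟩, h4⟩
    exact ⟨k, h2, h3, h1, h4⟩
  · rintro ⟨k, h2, h3, h1, h4⟩
    exact ⟨k, ⟨h1, h2, h3⟩, h4⟩

theorem intCast_inj_of_lt {N : ℕ} {k l : ℤ} (h : (k : ZMod N) = l) (hlt : |l - k| < N) :
    k = l := by
  rw [ZMod.intCast_eq_intCast_iff_dvd_sub] at h
  have := Int.eq_zero_of_abs_lt_dvd h hlt
  omega

theorem card_offsets {N h : ℕ} (hN : 2 * h < N) : (offsets N h).card = 2 * h := by
  rw [offsets, Finset.card_image_of_injOn]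
  · rw [Finset.card_erase_of_mem (by simp)]
    simp
    omega
  · intro k hk l hl hkl
    simp only [Finset.coe_erase, Finset.coe_Icc, Set.mem_sdiff, Set.mem_Icc] at hk hl
    refine intCast_inj_of_lt hkl ?_
    rw [abs_lt]
    omega

theorem neg_mem_offsets {N h : ℕ} {d : ZMod N} (hd : d ∈ offsets N h) : -d ∈ offsets N h := by
  rw [mem_offsets] at hd ⊢
  obtain ⟨k, h1, h2, h3, rfl⟩ := hd
  exact ⟨-k, by omega, by omega, by omega, by simp⟩

/-- The circulant graph on `ZMod N` with offsets `±1, …, ±h`. -/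
noncomputable def circulant (N h : ℕ) (hN : 2 * h < N) : Multigraph (ZMod N) where
  mult a b := if b - a ∈ offsets N h then 1 else 0
  mult_comm a b := by
    refine if_congr ⟨fun h => ?_, fun h => ?_⟩ rfl rfl
    · rw [← neg_sub]; exact neg_mem_offsets h
    · rw [← neg_sub]; exact neg_mem_offsets h
  mult_self a := by
    rw [if_neg]
    rw [sub_self, mem_offsets]
    rintro ⟨k, h1, h2, h3, h4⟩
    refine h3 (intCast_inj_of_lt (h4.trans Int.cast_zero.symm) ?_)
    rw [abs_lt]
    omega

theorem circulant_le_one {N h : ℕ} (hN : 2 * h < N) (a b : ZMod N) :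
    (circulant N h hN).mult a b ≤ 1 := by
  simp only [circulant]
  split_ifs <;> simp

theorem circulant_add {N h : ℕ} (hN : 2 * h < N) (a b c : ZMod N) :
    (circulant N h hN).mult (a + c) (b + c) = (circulant N h hN).mult a b := by
  simp [circulant]

theorem circulant_isRegular {N h : ℕ} [NeZero N] (hN : 2 * h < N) :
    (circulant N h hN).IsRegular (2 * h) := by
  intro a
  simp only [degree, circulant]
  rw [← Equiv.sum_comp (Equiv.addRight a)]
  simp [card_offsets hN]

/-- Take `a ∈ S` with `a + 1 ∉ S`. Every `w = a + k` with `-h < k ≤ h` and `k ≠ 0` yields its own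
cut edge: to `a` if `w ∉ S`, to `a + 1` if `w ∈ S`. These are `2h - 1` edges, and all cuts are even.
-/
theorem le_cutSize_circulant {N h : ℕ} [NeZero N] (hN : 2 * h < N) {S : Finset (ZMod N)}
    (h1 : S.Nonempty) (h2 : ∃ a, a ∉ S) : 2 * h ≤ (circulant N h hN).cutSize S := by
  classical
  rcases Nat.eq_zero_or_pos h with rfl | hpos
  · simp
  obtain ⟨a, ha, ha'⟩ : ∃ a ∈ S, a + 1 ∉ S := by
    by_contra! hcl
    obtain ⟨a, ha⟩ := h1
    obtain ⟨b, hb⟩ := h2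
    have : ∀ n : ℕ, a + n ∈ S := by
      intro n
      induction n with
      | zero => simpa using ha
      | succ n ih => have := hcl _ ih; push_cast; rwa [← add_assoc]
    have := this (b - a).val
    rw [ZMod.natCast_zmod_val] at this
    exact hb (by simpa using this)
  set C := circulant N h hN
  have hodd : 2 * h - 1 ≤ C.cutSize S := by
    -- Edges with inner end `a` and edges with outer end `a + 1` overlap only in the edge between
    -- these two; requiring `w ≠ a` avoids counting it twice.
    have hsplit : (∑ w, if w ∉ S then C.mult a w else 0) +
        (∑ w, if w ∈ S ∧ w ≠ a then C.mult w (a + 1) else 0) ≤ C.cutSize S := by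
      rw [cutSize_eq_sum]
      refine le_trans ?_ (Finset.add_sum_erase _ _ (Finset.mem_univ a)).le
      refine Nat.add_le_add (Finset.sum_le_sum fun w _ => by simp [ha]) ?_
      rw [← Finset.add_sum_erase _ _ (Finset.mem_univ a)]
      simp only [ne_eq, not_true_eq_false, and_false, if_false, zero_add]
      refine Finset.sum_le_sum fun w hw => ?_
      refine le_trans ?_ (Finset.single_le_sum
        (fun _ _ => Nat.zero_le _) (Finset.mem_univ (a + 1)))
      by_cases hwS : w ∈ S
      · simp only [hwS, ha', Finset.ne_of_mem_erase hw]
        simp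
      · simp [hwS]
    refine le_trans ?_ hsplit
    rw [← Finset.sum_add_distrib]
    -- The range is asymmetric because both `k` and `1 - k` must have absolute value at most `h`.
    set I : Finset (ZMod N) := ((Finset.Icc (-(h : ℤ) + 1) h).erase 0).image
      (fun k : ℤ => a + (k : ZMod N)) with hI
    have hcard : I.card = 2 * h - 1 := by
      rw [hI, Finset.card_image_of_injOn]
      · rw [Finset.card_erase_of_mem (by simp; omega)]
        simp
        omega
      · intro k hk l hl hkl
        simp only [Finset.coe_erase, Finset.coe_Icc, Set.mem_sdiff, Set.mem_Icc] at hk hl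
        refine intCast_inj_of_lt (add_left_cancel hkl) ?_
        rw [abs_lt]
        omega
    rw [← hcard, Finset.card_eq_sum_ones]
    refine le_trans (Finset.sum_le_sum fun w hw => ?_)
      (Finset.sum_le_sum_of_subset (Finset.subset_univ I))
    simp only [hI, Finset.mem_image, Finset.mem_erase, Finset.mem_Icc] at hw
    obtain ⟨k, ⟨hk0, hk1, hk2⟩, rfl⟩ := hw
    by_cases hw : a + (k : ZMod N) ∈ S
    · have hk : k ≠ 1 := by
        rintro rfl
        exact ha' (by simpa using hw)
      have hne : a + (k : ZMod N) ≠ a := by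
        intro h
        refine hk0 (intCast_inj_of_lt (N := N) (l := 0) (by simpa using h) ?_)
        rw [abs_lt]; omega
      have hm : a + 1 - (a + (k : ZMod N)) ∈ offsets N h :=
        mem_offsets.2 ⟨1 - k, by omega, by omega, by omega, by push_cast; ring⟩
      simp only [hw, hne, ne_eq, not_false_eq_true, and_self, if_true, not_true_eq_false, if_false,
        C, circulant, hm]
      simp
    · have hm : (k : ZMod N) ∈ offsets N h :=
        mem_offsets.2 ⟨k, by omega, by omega, by omega, rfl⟩
      simp [hw, C, circulant, hm]
  have heven := ((circulant_isRegular hN).even_cutSize S).2 (by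
    rw [mul_left_comm]; exact even_two_mul _)
  obtain ⟨k, hk⟩ := heven
  change C.cutSize S = _ at hk
  omega

/-! ### Circulant graphs on a labelled set of vertices -/

section Labelled

variable {V : Type*} {N h : ℕ}

open scoped Classical in
/-- The circulant graph carried over to the vertices in `L` by a labelling. -/
noncomputable def leafGraph (L : Set V) (lab : V → ZMod N) (hN : 2 * h < N) : Multigraph V where
  mult u v := if u ∈ L ∧ v ∈ L then (circulant N h hN).mult (lab u) (lab v) else 0
  mult_comm u v := by
    rw [mult_comm]
    exact if_congr and_comm rfl rfl
  mult_self v := by simp [mult_self]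

theorem leafGraph_pos {L : Set V} {lab : V → ZMod N} {hN : 2 * h < N} {u v : V}
    (hp : 0 < (leafGraph L lab hN).mult u v) : u ∈ L ∧ v ∈ L := by
  by_contra hn
  simp [leafGraph, hn] at hp

theorem leafGraph_le_one (L : Set V) (lab : V → ZMod N) (hN : 2 * h < N) (u v : V) :
    (leafGraph L lab hN).mult u v ≤ 1 := by
  simp only [leafGraph]
  split_ifs
  · exact circulant_le_one _ _ _
  · simp

open scoped Classical in
theorem sum_labelled [Fintype V] [NeZero N] {L : Set V} {lab : V → ZMod N}
    (hlab : Set.BijOn lab L Set.univ) (f : ZMod N → ℕ) :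
    (∑ v, if v ∈ L then f (lab v) else 0) = ∑ a, f a := by
  rw [← Finset.sum_filter]
  refine Finset.sum_nbij lab (by simp) ?_ ?_ (fun _ _ => rfl)
  · intro u hu v hv huv
    exact hlab.injOn (by simpa using hu) (by simpa using hv) huv
  · intro a _
    obtain ⟨v, hv, rfl⟩ := hlab.surjOn (Set.mem_univ a)
    exact ⟨v, by simpa using hv, rfl⟩

open scoped Classical in
theorem degree_leafGraph [Fintype V] [NeZero N] {L : Set V} {lab : V → ZMod N}
    (hlab : Set.BijOn lab L Set.univ) (hN : 2 * h < N) (v : V) :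
    (leafGraph L lab hN).degree v = if v ∈ L then 2 * h else 0 := by
  simp only [degree, leafGraph, ite_and]
  by_cases hv : v ∈ L
  · simp only [hv, if_true]
    rw [sum_labelled hlab]
    exact circulant_isRegular hN (lab v)
  · simp [hv]

/-- Vertices outside `L` contribute nothing, so the cut equals that of the set of labels of `S ∩ L`.
-/
theorem le_cutSize_leafGraph [Fintype V] [NeZero N] {L : Set V} {lab : V → ZMod N}
    (hlab : Set.BijOn lab L Set.univ) (hN : 2 * h < N) {S : Finset V} (h1 : ∃ v ∈ S, v ∈ L)
    (h2 : ∃ v ∈ L, v ∉ S) : 2 * h ≤ (leafGraph L lab hN).cutSize S := by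
  classical
  set S' : Finset (ZMod N) := Finset.univ.filter fun a => ∃ v ∈ S, v ∈ L ∧ lab v = a with hS'
  have hmem : ∀ v ∈ L, (lab v ∈ S' ↔ v ∈ S) := by
    intro v hv
    simp only [hS', Finset.mem_filter, Finset.mem_univ, true_and]
    constructor
    · rintro ⟨w, hw, hwL, hwv⟩
      rwa [← hlab.injOn hwL hv hwv]
    · exact fun h => ⟨v, h, hv, rfl⟩
  have hcut : (leafGraph L lab hN).cutSize S = (circulant N h hN).cutSize S' := by
    rw [cutSize_eq_sum, cutSize_eq_sum, ← sum_labelled hlab]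
    refine Finset.sum_congr rfl fun u _ => ?_
    by_cases hu : u ∈ L
    · simp only [hu, if_true]
      rw [← sum_labelled hlab]
      refine Finset.sum_congr rfl fun v _ => ?_
      by_cases hv : v ∈ L
      · simp [hu, hv, hmem, leafGraph]
      · simp [hv, leafGraph]
    · simp [hu, leafGraph]
  rw [hcut]
  obtain ⟨v, hv, hvL⟩ := h1
  obtain ⟨w, hwL, hw⟩ := h2
  exact le_cutSize_circulant hN ⟨lab v, (hmem v hvL).2 hv⟩ ⟨lab w, fun h => hw ((hmem w hwL).1 h)⟩

end Labelled

end Multigraph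

/-! ### Stars: trees with complete branches and a circulant graph on the leaves -/

namespace Multigraph

/-- The vertices of the complete `m`-ary tree with `p` levels: the empty list is the root, and the
children of `l` are the lists `a :: l`. -/
abbrev Branch (m p : ℕ) : Type := {l : List (Fin m) // l.length < p}

noncomputable instance (m p : ℕ) : Fintype (Branch m p) :=
  (List.finite_length_lt (Fin m) p).fintype

/-- The vertices of a tree with branches `Branch m (ht j)` below a common root `none`. -/
abbrev Star (ι : Type) (m : ℕ) (ht : ι → ℕ) : Type := Option (Σ j, Branch m (ht j))

namespace Star

variable {ι : Type} {m : ℕ} {ht : ι → ℕ}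

/-- The vertex at position `l` of the branch with index `j`. -/
def node (j : ι) (l : List (Fin m)) (h : l.length < ht j) : Star ι m ht := some ⟨j, l, h⟩

theorem cases (v : Star ι m ht) : v = none ∨ (∃ j h, v = node j [] h) ∨
    ∃ j a l h, v = node j (a :: l) h := by
  rcases v with _ | ⟨j, _ | ⟨a, l⟩, h⟩
  · exact Or.inl rfl
  · exact Or.inr (Or.inl ⟨j, h, rfl⟩)
  · exact Or.inr (Or.inr ⟨j, a, l, h, rfl⟩)

theorem node_inj {j k : ι} {l l' : List (Fin m)} {h : l.length < ht j} {h' : l'.length < ht k} :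
    (node j l h : Star ι m ht) = node k l' h' ↔ j = k ∧ l = l' := by
  unfold node
  constructor
  · intro e
    rw [Option.some.injEq, Sigma.mk.injEq] at e
    obtain ⟨rfl, e⟩ := e
    exact ⟨rfl, congrArg Subtype.val (eq_of_heq e)⟩
  · rintro ⟨rfl, rfl⟩
    rfl

theorem node_ne_none {j : ι} {l : List (Fin m)} {h : l.length < ht j} :
    (node j l h : Star ι m ht) ≠ none := by
  simp [node]

open scoped Classical in
/-- The parent of a vertex, where the branches in `A` are cut off from the root. -/
noncomputable def par (A : Set ι) : Star ι m ht → Option (Star ι m ht)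
  | none => none
  | some ⟨j, [], _⟩ => if j ∈ A then none else some none
  | some ⟨j, _ :: l, h⟩ => some (some ⟨j, l, (Nat.lt_succ_self _).trans h⟩)

/-- The distance from the root. -/
def dep : Star ι m ht → ℕ
  | none => 0
  | some ⟨_, l, _⟩ => l.length + 1

theorem par_none (A : Set ι) : par A (none : Star ι m ht) = none := rfl

open scoped Classical in
theorem par_root (A : Set ι) (j : ι) (h : ([] : List (Fin m)).length < ht j) :
    par A (node j [] h : Star ι m ht) = if j ∈ A then none else some none := rfl

theorem par_cons (A : Set ι) (j : ι) (a : Fin m) (l : List (Fin m)) (h : (a :: l).length < ht j) :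
    par A (node j (a :: l) h : Star ι m ht) =
      some (node j l ((Nat.lt_succ_self _).trans h)) := rfl

theorem par_eq_some_none {A : Set ι} {v : Star ι m ht} :
    par A v = some none ↔ ∃ j h, j ∉ A ∧ v = node j [] h := by
  classical
  rcases cases v with rfl | ⟨j, h, rfl⟩ | ⟨j, a, l, h, rfl⟩
  · simp [par_none, node]
  · rw [par_root]
    constructor
    · intro e
      refine ⟨j, h, fun hj => ?_, rfl⟩
      rw [if_pos hj] at e
      cases e
    · rintro ⟨k, h', hk, e⟩
      rw [(node_inj.1 e).1, if_neg hk]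
  · rw [par_cons]
    constructor
    · intro e
      simp [node] at e
    · rintro ⟨k, h', hk, e⟩
      exact absurd (node_inj.1 e).2 (by simp)

theorem par_eq_some_node {A : Set ι} {v : Star ι m ht} {j : ι} {l : List (Fin m)}
    {h : l.length < ht j} :
    par A v = some (node j l h) ↔ ∃ a h', v = node j (a :: l) h' := by
  classical
  rcases cases v with rfl | ⟨k, hk, rfl⟩ | ⟨k, b, l', hk, rfl⟩
  · simp [par_none, node]
  · rw [par_root]
    constructor
    · intro e
      split_ifs at e
      exact absurd (Option.some.inj e).symm node_ne_none
    · rintro ⟨a, h', e⟩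
      exact absurd (node_inj.1 e).2 (by simp)
  · rw [par_cons, Option.some.injEq, node_inj]
    constructor
    · rintro ⟨rfl, rfl⟩
      exact ⟨b, hk, rfl⟩
    · rintro ⟨a, h', e⟩
      have hinj := node_inj.1 e
      exact ⟨hinj.1, (List.cons.inj hinj.2).2⟩

/-- The forest that remains when the branches in `A` are cut off from the root. -/
noncomputable def forest (A : Set ι) (ht : ι → ℕ) (m : ℕ) : RootedForest (Star ι m ht) where
  par := par A
  dep := dep
  dep_par := by
    rintro v (_ | ⟨j, l, h⟩) e
    · obtain ⟨k, hk, _, rfl⟩ := par_eq_some_none.1 e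
      rfl
    · obtain ⟨a, h', rfl⟩ := par_eq_some_node.1 e
      rfl

/-- The leaves: the vertices in the last level of a branch. -/
def leaves (ht : ι → ℕ) (m : ℕ) : Set (Star ι m ht) :=
  {v | ∃ j l h, v = node j l h ∧ l.length + 1 = ht j}

theorem none_notMem_leaves : (none : Star ι m ht) ∉ leaves ht m := by
  rintro ⟨j, l, h, e, _⟩
  exact node_ne_none e.symm

theorem node_mem_leaves {j : ι} {l : List (Fin m)} {h : l.length < ht j} :
    (node j l h : Star ι m ht) ∈ leaves ht m ↔ l.length + 1 = ht j := by
  constructor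
  · rintro ⟨k, l', h', e, hl⟩
    obtain ⟨rfl, rfl⟩ := node_inj.1 e
    exact hl
  · exact fun hl => ⟨j, l, h, rfl, hl⟩

theorem par_ne_of_mem_leaves {A : Set ι} {u v : Star ι m ht} (hv : v ∈ leaves ht m) :
    par A u ≠ some v := by
  obtain ⟨j, l, h, rfl, hl⟩ := hv
  rw [Ne, par_eq_some_node]
  rintro ⟨a, h', -⟩
  rw [List.length_cons] at h'
  omega

variable {N h : ℕ}

/-- The forest together with a circulant graph on the leaves. -/
noncomputable def graph (A : Set ι) (lab : Star ι m ht → ZMod N) (hN : 2 * h < N) :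
    Multigraph (Star ι m ht) where
  mult u v := (forest A ht m).graph.mult u v + (leafGraph (leaves ht m) lab hN).mult u v
  mult_comm u v := by rw [mult_comm, mult_comm (leafGraph _ _ _)]
  mult_self v := by rw [mult_self, mult_self]

theorem graph_pos {A : Set ι} {lab : Star ι m ht → ZMod N} {hN : 2 * h < N} {u v : Star ι m ht}
    (hp : 0 < (graph A lab hN).mult u v) :
    (u ∈ leaves ht m ∧ v ∈ leaves ht m) ∨ par A u = some v ∨ par A v = some u := by
  rcases Nat.eq_zero_or_pos ((leafGraph (leaves ht m) lab hN).mult u v) with h0 | h0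
  · right
    change 0 < _ + (leafGraph (leaves ht m) lab hN).mult u v at hp
    rw [h0, add_zero, RootedForest.graph_pos] at hp
    exact hp
  · exact Or.inl (leafGraph_pos h0)

theorem graph_pos_of_par {A : Set ι} {lab : Star ι m ht → ZMod N} {hN : 2 * h < N}
    {u v : Star ι m ht} (hp : par A u = some v) : 0 < (graph A lab hN).mult u v :=
  Nat.add_pos_left ((forest A ht m).graph_pos.2 (Or.inl hp)) _

theorem graph_isSimple (A : Set ι) (lab : Star ι m ht → ZMod N) (hN : 2 * h < N) :
    (graph A lab hN).IsSimple := by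
  intro u v
  have h1 := (forest A ht m).graph_le_one u v
  have h2 := leafGraph_le_one (leaves ht m) lab hN u v
  change _ + _ ≤ 1
  rcases Nat.eq_zero_or_pos ((leafGraph (leaves ht m) lab hN).mult u v) with h0 | h0
  · omega
  · obtain ⟨hu, hv⟩ := leafGraph_pos h0
    have h3 : ¬ 0 < (forest A ht m).graph.mult u v := by
      rw [RootedForest.graph_pos]
      rintro (h | h)
      · exact par_ne_of_mem_leaves hv h
      · exact par_ne_of_mem_leaves hu h
    omega

variable [Fintype ι]

-- The edges lost by cutting off `A` are those from the root to the tops of these branches. `A =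
-- {0}` describes a gadget with one edge removed, `A = univ` the base of the wheel.
open scoped Classical in
theorem graph_empty_eq (hpos : ∀ j, 0 < ht j) (A : Set ι) (lab : Star ι m ht → ZMod N)
    (hN : 2 * h < N) (u v : Star ι m ht) :
    (graph ∅ lab hN).mult u v = (graph A lab hN).mult u v +
      ∑ j, if j ∈ A then edgeCount none (node j [] (hpos j)) u v else 0 := by
  have key : ∀ u v : Star ι m ht, (if par ∅ u = some v then 1 else 0) =
      (if par A u = some v then 1 else 0) +
      ∑ j, if j ∈ A then (if u = node j [] (hpos j) ∧ v = none then 1 else 0) else 0 := by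
    intro u v
    rcases cases v with rfl | ⟨j, l, rfl⟩ | ⟨k, b, l', hk, rfl⟩
    · rcases cases u with rfl | ⟨j, l, rfl⟩ | ⟨k, b, l', hk, rfl⟩
      · simp [par_none, node_ne_none.symm]
      · have : ∀ k, (node j [] l : Star ι m ht) = node k [] (hpos k) ↔ j = k := fun k => by
          simp [node_inj]
        simp only [par_root, this, Set.mem_empty_iff_false, if_false, and_true]
        rw [Finset.sum_eq_single j (fun k _ hk => by simp [hk.symm]) (by simp)]
        by_cases hj : j ∈ A <;> simp [hj]
      · simp [par_cons, node_inj]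
    · simp [par_eq_some_node, node_ne_none]
    · simp [par_eq_some_node, node_ne_none]
  have hu := key u v
  have hv := key v u
  have h3 : (∑ j, if j ∈ A then edgeCount none (node j [] (hpos j)) u v else 0) =
      (∑ j, if j ∈ A then (if u = node j [] (hpos j) ∧ v = none then 1 else 0) else 0) +
      ∑ j, if j ∈ A then (if v = node j [] (hpos j) ∧ u = none then 1 else 0) else 0 := by
    rw [← Finset.sum_add_distrib]
    refine Finset.sum_congr rfl fun j _ => ?_
    by_cases hj : j ∈ A
    · simp only [hj, if_true]
      rw [edgeCount_eq node_ne_none.symm, add_comm]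
      congr 1
      · congr
      · by_cases h1 : u = none <;> by_cases h2 : v = node j [] (hpos j) <;> simp [h1, h2]
    · simp [hj]
  have hg : ∀ A, (forest A ht m).graph.mult u v =
      (if par A u = some v then 1 else 0) + (if par A v = some u then 1 else 0) := fun A => by
    simp only [RootedForest.graph, forest]
    congr
  simp only [graph]
  rw [h3, hg, hg]
  omega

/-- The root has `m + 1` branches, an inner vertex has a parent and `m` children, and at a leaf the
circulant supplies `2h = m` edges in place of the children. -/
theorem graph_isRegular [NeZero N] (hpos : ∀ j, 0 < ht j) (hι : Fintype.card ι = m + 1)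
    {lab : Star ι m ht → ZMod N} (hlab : Set.BijOn lab (leaves ht m) Set.univ) (hN : 2 * h < N)
    (hm : m = 2 * h) : (graph ∅ lab hN).IsRegular (m + 1) := by
  classical
  intro v
  have hsum : (graph ∅ lab hN).degree v =
      (forest ∅ ht m).graph.degree v + (leafGraph (leaves ht m) lab hN).degree v := by
    simp only [degree, graph, Finset.sum_add_distrib]
  have hforest : (forest ∅ ht m).graph.degree v = (if par ∅ v = none then 0 else 1) +
      (Finset.univ.filter fun u => par ∅ u = some v).card := by
    rw [RootedForest.degree_graph]
    simp only [forest]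
    congr
  rw [hsum, hforest, degree_leafGraph hlab]
  rcases v with _ | ⟨j, l, hl⟩
  · have : (Finset.univ.filter fun u : Star ι m ht => par ∅ u = some none) =
        Finset.univ.image fun j => node j [] (hpos j) := by
      ext u
      simp only [Finset.mem_filter, Finset.mem_univ, true_and, Finset.mem_image, par_eq_some_none]
      constructor
      · rintro ⟨j, h, -, rfl⟩
        exact ⟨j, rfl⟩
      · rintro ⟨j, rfl⟩
        exact ⟨j, hpos j, by simp, rfl⟩
    rw [this, Finset.card_image_of_injective _ (fun j k e => (node_inj.1 e).1), Finset.card_univ,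
      if_neg none_notMem_leaves, par_none, hι]
    simp
  · have hpar : par ∅ (some ⟨j, l, hl⟩ : Star ι m ht) ≠ none := by
      cases l <;> simp [par]
    rw [if_neg hpar]
    change _ + (Finset.univ.filter fun u => par ∅ u = some (node j l hl)).card +
      (if node j l hl ∈ leaves ht m then _ else _) = _
    rw [node_mem_leaves]
    by_cases hleaf : l.length + 1 = ht j
    · have : (Finset.univ.filter fun u : Star ι m ht => par ∅ u = some (node j l hl)) = ∅ := by
        ext u
        simpa using par_ne_of_mem_leaves (node_mem_leaves.2 hleaf)
      rw [if_pos hleaf, this, hm]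
      simp [add_comm]
    · have hlt : l.length + 1 < ht j := by omega
      have : (Finset.univ.filter fun u : Star ι m ht => par ∅ u = some (node j l hl)) =
          Finset.univ.image fun a => node j (a :: l) hlt := by
        ext u
        simp only [Finset.mem_filter, Finset.mem_univ, true_and, Finset.mem_image,
          par_eq_some_node]
        constructor
        · rintro ⟨a, h, rfl⟩
          exact ⟨a, rfl⟩
        · rintro ⟨a, rfl⟩
          exact ⟨a, hlt, rfl⟩
      rw [this, Finset.card_image_of_injective _
        (fun a b e => (List.cons.inj (node_inj.1 e).2).1), if_neg hleaf]
      simp [add_comm]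

theorem graph_isRGraph [NeZero N] (hpos : ∀ j, 0 < ht j) (hι : Fintype.card ι = m + 1)
    {lab : Star ι m ht → ZMod N} (hlab : Set.BijOn lab (leaves ht m) Set.univ) (hN : 2 * h < N)
    (hm : m = 2 * h) (hh : 0 < h) : (graph ∅ lab hN).IsRGraph (m + 1) := by
  refine (forest ∅ ht m).isRGraph_of_leaves (by rw [hm]; exact odd_two_mul_add_one h) (by omega)
    (graph_isRegular hpos hι hlab hN hm) (R := leafGraph (leaves ht m) lab hN)
    (fun _ _ => rfl) (leaves ht m) (fun u v hu => ?_) fun S h1 h2 => ?_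
  · by_contra hne
    exact hu (leafGraph_pos (Nat.pos_of_ne_zero hne)).1
  · have := le_cutSize_leafGraph hlab hN h1 h2
    omega

/-- Each of the `m + 1` branches contains a leaf, so there are more than `m` leaves, as the
circulant requires. -/
theorem exists_labelling (hpos : ∀ j, 0 < ht j) (hι : Fintype.card ι = m + 1) (hm : 0 < m) :
    ∃ (N : ℕ) (_ : NeZero N) (lab : Star ι m ht → ZMod N),
      m < N ∧ Set.BijOn lab (leaves ht m) Set.univ := by
  classical
  have hlt : m < Fintype.card (leaves ht m) := by
    have : Fintype.card ι ≤ Fintype.card (leaves ht m) := by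
      refine Fintype.card_le_of_injective (fun j => ⟨node j (List.replicate (ht j - 1) ⟨0, hm⟩)
        (by have := hpos j; simp; omega), node_mem_leaves.2 ?_⟩) ?_
      · have := hpos j; simp; omega
      · intro j k e
        exact (node_inj.1 (congrArg Subtype.val e)).1
    omega
  have : NeZero (Fintype.card (leaves ht m)) := ⟨by omega⟩
  have e : leaves ht m ≃ ZMod (Fintype.card (leaves ht m)) :=
    Fintype.equivOfCardEq (by rw [ZMod.card])
  refine ⟨_, this, fun v => if hv : v ∈ leaves ht m then e ⟨v, hv⟩ else 0, hlt,
    fun _ _ => Set.mem_univ _, ?_, ?_⟩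
  · intro u hu v hv huv
    simp only [hu, hv, dif_pos] at huv
    exact congrArg Subtype.val (e.injective huv)
  · intro a _
    exact ⟨(e.symm a).1, (e.symm a).2, by simp⟩

/-- Number the `M` leaves of one branch by `0, …, M - 1` and add `M * j` on branch `j`. Modulo `r *
M`, passing to the next branch adds `M`, also when the last branch wraps round to the first. -/
theorem exists_equivariant_labelling {r q : ℕ} [NeZero r] (hr : m < r) (hm : 0 < m) (hq : 0 < q) :
    ∃ (N : ℕ) (_ : NeZero N) (lab : Star (ZMod r) m (fun _ => q) → ZMod N) (c : ZMod N),
      m < N ∧ Set.BijOn lab (leaves (fun _ => q) m) Set.univ ∧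
      ∀ (j : ZMod r) (b : Branch m q), lab (some ⟨j + 1, b⟩) = lab (some ⟨j, b⟩) + c := by
  classical
  let L : Set (Branch m q) := {b | b.1.length + 1 = q}
  have hL : 0 < Fintype.card L := Fintype.card_pos_iff.2
    ⟨⟨⟨List.replicate (q - 1) ⟨0, hm⟩, by simp; omega⟩, by simp [L]; omega⟩⟩
  set M := Fintype.card L with hM
  have e : L ≃ Fin M := Fintype.equivFin L
  let f : Branch m q → ℕ := fun b => if hb : b ∈ L then (e ⟨b, hb⟩).val else 0
  have hf : ∀ b, f b < M := by
    intro b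
    simp only [f]
    split_ifs
    · exact (e _).2
    · exact hL
  have hfinj : ∀ b ∈ L, ∀ b' ∈ L, f b = f b' → b = b' := by
    intro b hb b' hb' h
    simp only [f, hb, hb', dif_pos] at h
    exact congrArg Subtype.val (e.injective (Fin.ext h))
  have hbound : ∀ (j : ZMod r) b, f b + M * j.val < r * M := by
    intro j b
    have h1 := hf b
    have h2 : j.val + 1 ≤ r := ZMod.val_lt j
    have h3 := Nat.mul_le_mul_left M h2
    rw [Nat.mul_comm r M]
    rw [Nat.mul_add] at h3
    omega
  have hne : NeZero (r * M) := ⟨Nat.mul_ne_zero (NeZero.ne r) hL.ne'⟩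
  let lab : Star (ZMod r) m (fun _ => q) → ZMod (r * M) := fun v =>
    match v with
    | none => 0
    | some ⟨j, b⟩ => ((f b + M * j.val : ℕ) : ZMod (r * M))
  refine ⟨r * M, hne, lab, ((M : ℕ) : ZMod (r * M)), ?_, ⟨fun _ _ => Set.mem_univ _, ?_, ?_⟩, ?_⟩
  · exact hr.trans_le (Nat.le_mul_of_pos_right r hL)
  · rintro u ⟨j, l, hl, rfl, hjl⟩ v ⟨k, l', hl', rfl, hkl⟩ huv
    have h1 : ((f ⟨l, hl⟩ + M * j.val : ℕ) : ZMod (r * M)) = ((f ⟨l', hl'⟩ + M * k.val : ℕ)) := huv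
    rw [ZMod.natCast_eq_natCast_iff, Nat.ModEq, Nat.mod_eq_of_lt (hbound _ _),
      Nat.mod_eq_of_lt (hbound _ _)] at h1
    have h2 : f ⟨l, hl⟩ = f ⟨l', hl'⟩ := by
      have := congrArg (· % M) h1
      simpa [Nat.mod_eq_of_lt (hf _)] using this
    have h3 : j.val = k.val := by
      rw [h2] at h1
      exact Nat.eq_of_mul_eq_mul_left hL (Nat.add_left_cancel h1)
    have h4 := hfinj _ hjl _ hkl h2
    rw [node_inj]
    exact ⟨ZMod.val_injective r h3, congrArg Subtype.val h4⟩
  · intro a _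
    have ha := ZMod.val_lt a
    have hdiv : a.val / M < r := Nat.div_lt_of_lt_mul (ha.trans_eq (Nat.mul_comm _ _))
    set b := e.symm ⟨a.val % M, Nat.mod_lt _ hL⟩ with hb
    refine ⟨node ((a.val / M : ℕ) : ZMod r) b.1.1 b.1.2, node_mem_leaves.2 b.2, ?_⟩
    change ((f b.1 + M * ((a.val / M : ℕ) : ZMod r).val : ℕ) : ZMod (r * M)) = a
    have h1 : f b.1 = a.val % M := by
      simp only [f]
      rw [dif_pos b.2]
      simp [hb]
    rw [h1, ZMod.val_natCast, Nat.mod_eq_of_lt hdiv, Nat.mod_add_div, ZMod.natCast_zmod_val]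
  · intro j b
    change ((f b + M * (j + 1).val : ℕ) : ZMod (r * M)) =
      ((f b + M * j.val : ℕ) : ZMod (r * M)) + ((M : ℕ) : ZMod (r * M))
    rw [← Nat.cast_add, add_assoc, Nat.cast_add (f b), Nat.cast_add (f b)]
    congr 1
    rw [ZMod.natCast_eq_natCast_iff]
    have h1 : (j + 1).val ≡ j.val + 1 [MOD r] := by
      rw [← ZMod.natCast_eq_natCast_iff]
      push_cast
      simp
    have h2 := Nat.ModEq.mul_left' M h1
    rw [Nat.mul_comm M r] at h2
    rwa [Nat.mul_add, Nat.mul_one] at h2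

end Star
end Multigraph

/-! ### Edge families, spanning trees and bridges -/

namespace Multigraph

variable {V : Type u}

/-- The edges of a finite graph form a finite family. -/
theorem exists_edge_family [Fintype V] (H : Multigraph V) :
    ∃ (J : Type u) (_ : Fintype J) (s t : J → V), (∀ j, s j ≠ t j) ∧
      ∀ u v, H.mult u v = ∑ j, edgeCount (s j) (t j) u v := by
  classical
  -- An arbitrary linear order on the vertices, so that each edge is listed in only one of its two
  -- orientations.
  let o : V ≃ Fin (Fintype.card V) := Fintype.equivFin V
  let c : V × V → ℕ := fun p => if o p.1 < o p.2 then H.mult p.1 p.2 else 0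
  have hlt : ∀ p : V × V, Fin (c p) → o p.1 < o p.2 := fun p k => by
    by_contra hn
    have : c p = 0 := if_neg hn
    exact (this ▸ k).elim0
  have hne : ∀ j : Σ p : V × V, Fin (c p), j.1.1 ≠ j.1.2 := fun j h => by
    have := hlt j.1 j.2
    rw [h] at this
    exact lt_irrefl _ this
  refine ⟨Σ p : V × V, Fin (c p), inferInstance, fun j => j.1.1, fun j => j.1.2, hne, ?_⟩
  have main : ∀ u v, o u < o v →
      H.mult u v = ∑ j : Σ p : V × V, Fin (c p), edgeCount j.1.1 j.1.2 u v := by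
    intro u v huv
    rw [Fintype.sum_sigma, Finset.sum_eq_single (u, v)]
    · simp [edgeCount, c, huv]
    · rintro ⟨a, b⟩ _ hab
      refine Finset.sum_eq_zero fun k _ => ?_
      unfold edgeCount
      rw [if_neg]
      rintro (⟨rfl, rfl⟩ | ⟨rfl, rfl⟩)
      · exact hab rfl
      · exact lt_asymm huv (hlt _ k)
    · simp
  intro u v
  rcases lt_trichotomy (o u) (o v) with h | h | h
  · exact main u v h
  · obtain rfl := o.injective h
    rw [H.mult_self, Finset.sum_eq_zero fun j _ => edgeCount_self (hne j) u]
  · rw [H.mult_comm, main v u h]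
    exact Finset.sum_congr rfl fun j _ => edgeCount_comm _ _ _ _

/-- A connected graph has a spanning tree with a given root. -/
theorem Connected.exists_rootedForest {G : Multigraph V} (hG : G.Connected) (x : V) :
    ∃ F : RootedForest V, (∀ v, F.par v = none ↔ v = x) ∧ F.dep x = 0 ∧
      ∀ {u v}, F.par u = some v → 0 < G.mult u v := by
  classical
  have hstep : ∀ v, v ≠ x → ∃ u, 0 < G.mult v u ∧
      G.toSimpleGraph.dist v x = G.toSimpleGraph.dist u x + 1 := by
    intro v hv
    obtain ⟨w, hw⟩ := hG.exists_walk_length_eq_dist v x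
    cases w with
    | nil => exact absurd rfl hv
    | @cons _ u _ hadj p =>
      refine ⟨u, hadj, le_antisymm ?_ ?_⟩
      · obtain ⟨p', hp'⟩ := hG.exists_walk_length_eq_dist u x
        have := SimpleGraph.dist_le (SimpleGraph.Walk.cons hadj p')
        rwa [SimpleGraph.Walk.length_cons, hp'] at this
      · rw [← hw, SimpleGraph.Walk.length_cons]
        exact Nat.add_le_add_right (SimpleGraph.dist_le p) 1
  choose p hp using hstep
  refine ⟨{ par := fun v => if h : v = x then none else some (p v h)
            dep := fun v => G.toSimpleGraph.dist v x
            dep_par := ?_ }, ?_, ?_, ?_⟩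
  · intro v u h
    split_ifs at h with hv
    rw [← Option.some.inj h]
    exact (hp v hv).2
  · intro v
    by_cases hv : v = x <;> simp [hv]
  · simp
  · intro u v h
    simp only at h
    split_ifs at h with hv
    rw [← Option.some.inj h]
    exact (hp u hv).1

/-- An `r`-graph with `r > 1` has no bridge. -/
theorem IsRGraph.connected_of_add_edge [Fintype V] {G N : Multigraph V} {r : ℕ}
    (hr2 : 2 ≤ r) (hG : G.IsRGraph r) (hconn : G.Connected) {x y : V} (hxy : x ≠ y)
    (h : ∀ u v, G.mult u v = N.mult u v + edgeCount x y u v) : N.Connected := by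
  classical
  -- Otherwise the component of `x` in `N` has `xy` as its only boundary edge in `G`. A cut of size
  -- 1 is odd, so the component is odd and `r ≤ 1`.
  have hreach : N.toSimpleGraph.Reachable x y := by
    by_contra hn
    let S : Finset V := Finset.univ.filter fun v => N.toSimpleGraph.Reachable x v
    have hN : N.cutSize S = 0 := by
      rw [cutSize_eq_sum]
      refine Finset.sum_eq_zero fun u _ => Finset.sum_eq_zero fun v _ => ?_
      split_ifs with huv
      · by_contra hne
        simp only [S, Finset.mem_filter, Finset.mem_univ, true_and] at huv
        exact huv.2 (huv.1.trans (SimpleGraph.Adj.reachable (Nat.pos_of_ne_zero hne)))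
      · rfl
    have hcut := cutSize_add_edge G N hxy h S
    have hx : x ∈ S := by simp [S]
    have hy : y ∉ S := by simp [S, hn]
    have hsep : sep (x ∈ S) (y ∈ S) = 1 := by simp [sep, hx, hy]
    rw [hN, hsep] at hcut
    have hodd : Odd S.card := by
      by_contra hev
      rw [Nat.not_odd_iff_even] at hev
      have := (hG.1.even_cutSize S).2 (hev.mul_right r)
      rw [hcut] at this
      exact absurd this (by decide)
    have := hG.2 S hodd
    omega
  have hadj : ∀ {u v}, G.toSimpleGraph.Adj u v → N.toSimpleGraph.Reachable u v := by
    intro u v huv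
    by_cases hN : 0 < N.mult u v
    · exact SimpleGraph.Adj.reachable hN
    · have h1 : 0 < G.mult u v := huv
      rw [h, Nat.eq_zero_of_not_pos hN, zero_add] at h1
      unfold edgeCount at h1
      split_ifs at h1 with h2
      · rcases h2 with ⟨rfl, rfl⟩ | ⟨rfl, rfl⟩
        · exact hreach
        · exact hreach.symm
      · exact absurd h1 (lt_irrefl 0)
  refine { preconnected := fun u v => ?_, nonempty := hconn.nonempty }
  obtain ⟨w⟩ := hconn.preconnected u v
  induction w with
  | nil => exact SimpleGraph.Reachable.refl _
  | cons h _ ih => exact (hadj h).trans ih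

end Multigraph

/-! ### Gadgets replacing the edges outside a spanning tree -/

namespace Multigraph

theorem Star.par_singleton_eq_none {ι : Type} {m : ℕ} {ht : ι → ℕ} {k : ι} {w : Star ι m ht} :
    Star.par {k} w = none ↔ w = none ∨ ∃ h, w = Star.node k [] h := by
  classical
  rcases Star.cases w with rfl | ⟨j, h, rfl⟩ | ⟨j, a, l, h, rfl⟩
  · simp [Star.par_none]
  · rw [Star.par_root]
    simp [Star.node_inj, Star.node_ne_none]
    rintro rfl
    exact h
  · simp [Star.par_cons, Star.node_inj, Star.node_ne_none]

section Gadgets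

variable {V : Type*} {J : Type*} {m : ℕ} (F : RootedForest V) (s t : J → V) (D : ℕ)

/-- The heights of the branches of the gadget that replaces the edge with index `j`: the branch
with index `0` is attached to `t j`, the other ones belong to the tree attached to `s j`. -/
def gadgetHeight (j : J) (k : Fin (m + 1)) : ℕ :=
  -- Branch 0 starts at depth `dep (t j) + 1`, the others at `dep (s j) + 2`, below the root of the
  -- star; with these heights all of them end at depth `D`.
  if k = 0 then D - F.dep (t j) else D - F.dep (s j) - 1

open scoped Classical in
/-- The parents in the forest that arises when gadgets are attached. -/
noncomputable def gadgetPar :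
    (V ⊕ Σ j, Star (Fin (m + 1)) m (gadgetHeight F s t D j)) →
      Option (V ⊕ Σ j, Star (Fin (m + 1)) m (gadgetHeight F s t D j))
  | .inl v => (F.par v).map .inl
  | .inr ⟨j, w⟩ =>
    match Star.par {0} w with
    | some w' => some (.inr ⟨j, w'⟩)
    | none => if w = none then some (.inl (s j)) else some (.inl (t j))

/-- The depths in the forest that arises when gadgets are attached. -/
def gadgetDep : (V ⊕ Σ j, Star (Fin (m + 1)) m (gadgetHeight F s t D j)) → ℕ
  | .inl v => F.dep v
  | .inr ⟨j, none⟩ => F.dep (s j) + 1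
  | .inr ⟨j, some ⟨k, l, _⟩⟩ =>
    if k = 0 then F.dep (t j) + 1 + l.length else F.dep (s j) + 2 + l.length

variable {F s t D}

theorem gadgetPar_inl {u : V} {v} : gadgetPar (m := m) F s t D (.inl u) = some v ↔
    ∃ w, v = .inl w ∧ F.par u = some w := by
  simp only [gadgetPar, Option.map_eq_some_iff]
  constructor
  · rintro ⟨w, h1, rfl⟩
    exact ⟨w, rfl, h1⟩
  · rintro ⟨w, rfl, h1⟩
    exact ⟨w, h1, rfl⟩

theorem gadgetPar_of_par {j : J} {w w'} (h : Star.par {0} w = some w') :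
    gadgetPar (m := m) F s t D (.inr ⟨j, w⟩) = some (.inr ⟨j, w'⟩) := by
  simp only [gadgetPar, h]

theorem gadgetPar_none (j : J) :
    gadgetPar (m := m) F s t D (.inr ⟨j, none⟩) = some (.inl (s j)) := by
  simp [gadgetPar, Star.par]

theorem gadgetPar_root (j : J) (h) :
    gadgetPar (m := m) F s t D (.inr ⟨j, Star.node 0 [] h⟩) = some (.inl (t j)) := by
  have : Star.par (ht := gadgetHeight (m := m) F s t D j) {0} (Star.node 0 [] h) = none :=
    Star.par_singleton_eq_none.2 (Or.inr ⟨h, rfl⟩)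
  simp [gadgetPar, this, Star.node_ne_none]

theorem gadgetPar_inr {j : J} {w v} (h : gadgetPar (m := m) F s t D (.inr ⟨j, w⟩) = some v) :
    (∃ w', Star.par {0} w = some w' ∧ v = .inr ⟨j, w'⟩) ∨ (w = none ∧ v = .inl (s j)) ∨
      ∃ h, w = Star.node 0 [] h ∧ v = .inl (t j) := by
  cases hp : Star.par {0} w with
  | some w' =>
    rw [gadgetPar_of_par hp] at h
    exact Or.inl ⟨w', rfl, (Option.some.inj h).symm⟩
  | none =>
    rcases Star.par_singleton_eq_none.1 hp with rfl | ⟨h', rfl⟩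
    · rw [gadgetPar_none] at h
      exact Or.inr (Or.inl ⟨rfl, (Option.some.inj h).symm⟩)
    · rw [gadgetPar_root] at h
      exact Or.inr (Or.inr ⟨h', rfl, (Option.some.inj h).symm⟩)

variable (F s t D m) in
/-- The forest that arises when gadgets are attached. -/
noncomputable def gadgetForest :
    RootedForest (V ⊕ Σ j, Star (Fin (m + 1)) m (gadgetHeight F s t D j)) where
  par := gadgetPar F s t D
  dep := gadgetDep F s t D
  dep_par := by
    rintro (u | ⟨j, w⟩) v h
    · obtain ⟨w, rfl, h1⟩ := gadgetPar_inl.1 h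
      exact F.dep_par h1
    · rcases gadgetPar_inr h with ⟨w', h1, rfl⟩ | ⟨rfl, rfl⟩ | ⟨h', rfl, rfl⟩
      · rcases w' with _ | ⟨k, l, hl⟩
        · obtain ⟨k, h2, hk, rfl⟩ := Star.par_eq_some_none.1 h1
          have : k ≠ 0 := hk
          simp [gadgetDep, Star.node, this]
        · obtain ⟨a, h2, rfl⟩ := Star.par_eq_some_node.1 h1
          simp only [gadgetDep, Star.node, List.length_cons]
          split_ifs <;> rfl
      · rfl
      · rfl

variable [Fintype J] [Fintype V]

/-- The removed edge splits the tree of the star into two trees, hung below `s j` and `t j`; both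
links become tree edges. Only the circulant edges remain outside the forest, and their ends are
leaves of depth `D`. -/
theorem gadgetForest_isTrimmed (hDs : ∀ j, F.dep (s j) + 2 ≤ D) (hDt : ∀ j, F.dep (t j) + 2 ≤ D)
    {σ : Substitution V J fun j => Star (Fin (m + 1)) m (gadgetHeight F s t D j)}
    (hbase : σ.base = F.graph) (hs : σ.s = s) (ht : σ.t = t) (hx : ∀ j, σ.x j = none)
    (hy : ∀ j, ∃ h, σ.y j = Star.node 0 [] h)
    (hpiece : ∀ j, ∃ (N h : ℕ) (lab : _ → ZMod N) (hN : 2 * h < N),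
      σ.piece j = Star.graph {0} lab hN) :
    (gadgetForest m F s t D).IsTrimmed σ.graph D where
  simple := by
    have hlink : ∀ u q, σ.link u q ≤ 1 := fun u q => Substitution.link_le_one (by
      obtain ⟨h, hy⟩ := hy q.1
      rw [hx, hy]
      exact Star.node_ne_none.symm)
    rintro (u | ⟨i, v⟩) (w | ⟨j, z⟩)
    · rw [Substitution.graph_inl_inl, hbase]
      exact F.graph_le_one u w
    · exact hlink _ _
    · exact hlink _ _
    · rw [Substitution.graph_inr_inr]
      by_cases hij : i = j
      · subst hij
        rw [Substitution.inner_same]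
        obtain ⟨N, h, lab, hN, hp⟩ := hpiece i
        rw [hp]
        exact Star.graph_isSimple _ _ _ _ _
      · rw [Substitution.inner_of_ne _ hij]
        simp
  par_adj := by
    rintro (u | ⟨j, w⟩) v h
    · obtain ⟨w, rfl, h1⟩ := gadgetPar_inl.1 h
      rw [Substitution.graph_inl_inl, hbase]
      exact F.graph_pos.2 (Or.inl h1)
    · rcases gadgetPar_inr h with ⟨w', h1, rfl⟩ | ⟨rfl, rfl⟩ | ⟨h', rfl, rfl⟩
      · rw [Substitution.graph_inr_inr, Substitution.inner_same]
        obtain ⟨N, h, lab, hN, hp⟩ := hpiece j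
        rw [hp]
        exact Star.graph_pos_of_par h1
      · exact Substitution.link_pos.2 (Or.inl ⟨by rw [hs], (hx j).symm⟩)
      · obtain ⟨h, hy⟩ := hy j
        exact Substitution.link_pos.2 (Or.inr ⟨by rw [ht], hy.symm⟩)
  good := by
    have hlink : ∀ {u q}, 0 < σ.link u q → gadgetPar F s t D (.inr q) = some (.inl u) := by
      rintro u ⟨j, w⟩ h
      rcases Substitution.link_pos.1 h with ⟨rfl, h2⟩ | ⟨rfl, h2⟩
      · simp only [hx] at h2
        subst h2
        rw [gadgetPar_none, hs]
      · obtain ⟨h', hy⟩ := hy j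
        simp only [hy] at h2
        subst h2
        rw [gadgetPar_root, ht]
    rintro (v | ⟨j, w⟩)
    · right
      rintro (u | q) h
      · rw [Substitution.graph_inl_inl, hbase, RootedForest.graph_pos] at h
        rcases h with h | h
        · exact Or.inl (gadgetPar_inl.2 ⟨u, rfl, h⟩)
        · exact Or.inr (gadgetPar_inl.2 ⟨v, rfl, h⟩)
      · exact Or.inr (hlink h)
    · by_cases hw : w ∈ Star.leaves (gadgetHeight F s t D j) m
      · left
        constructor
        · rintro (u | ⟨i, z⟩) h
          · obtain ⟨_, h, _⟩ := gadgetPar_inl.1 h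
            cases h
          · rcases gadgetPar_inr h with ⟨w', h1, h2⟩ | ⟨_, h2⟩ | ⟨_, _, h2⟩
            · simp only [Sum.inr.injEq, Sigma.mk.injEq] at h2
              obtain ⟨rfl, h2⟩ := h2
              rw [eq_of_heq h2] at hw
              exact Star.par_ne_of_mem_leaves hw h1
            · cases h2
            · cases h2
        · obtain ⟨k, l, hl, rfl, hk⟩ := hw
          have h1 := hDs j
          have h2 := hDt j
          simp only [gadgetForest, gadgetDep, Star.node, gadgetHeight] at hk ⊢
          split_ifs at hk ⊢ <;> omega
      · right
        rintro (u | ⟨i, z⟩) h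
        · exact Or.inl (hlink h)
        · rw [Substitution.graph_inr_inr] at h
          by_cases hij : j = i
          · subst hij
            rw [Substitution.inner_same] at h
            obtain ⟨N, _, lab, hN, hp⟩ := hpiece j
            rw [hp] at h
            rcases Star.graph_pos h with h | h | h
            · exact absurd h.1 hw
            · exact Or.inl (gadgetPar_of_par h)
            · exact Or.inr (gadgetPar_of_par h)
          · rw [Substitution.inner_of_ne _ hij] at h
            exact absurd h (lt_irrefl 0)

end Gadgets

/-- Every connected `r`-graph can be obtained from an `r`-graph that, after removing some edge
`xy`, has a spanning tree with root `x` in which every vertex is a leaf of fixed depth or has only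
edges of the tree. -/
theorem IsRGraph.exists_trimmed {V : Type u} [Fintype V] {G : Multigraph V} {h : ℕ} (hh : 0 < h)
    (hG : G.IsRGraph (2 * h + 1)) (hconn : G.Connected) :
    ∃ (W : Type u) (_ : Fintype W) (K N : Multigraph W) (x y : W) (F : RootedForest W) (D : ℕ),
      x ≠ y ∧ (∀ u v, K.mult u v = N.mult u v + edgeCount x y u v) ∧ K.IsRGraph (2 * h + 1) ∧
      G.IsObtainedFrom (2 * h + 1) K ∧ (∀ v, F.par v = none ↔ v = x) ∧ F.dep x = 0 ∧
      F.IsTrimmed N D ∧ F.dep y < D := by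
  classical
  have hr : Odd (2 * h + 1) := odd_two_mul_add_one h
  obtain ⟨x⟩ := hconn.nonempty
  obtain ⟨y, hy⟩ : ∃ y, 0 < G.mult x y := by
    by_contra! hn
    have := hG.1 x
    rw [degree, Finset.sum_eq_zero fun y _ => Nat.le_zero.1 (hn y)] at this
    omega
  have hxy : x ≠ y := by
    rintro rfl
    rw [G.mult_self] at hy
    exact lt_irrefl 0 hy
  have hle : ∀ u v, edgeCount x y u v ≤ G.mult u v := by
    intro u v
    unfold edgeCount
    split_ifs with h
    · rcases h with ⟨rfl, rfl⟩ | ⟨rfl, rfl⟩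
      · exact hy
      · rw [G.mult_comm]; exact hy
    · exact Nat.zero_le _
  -- `N₀` is `G - xy`; below, `R` consists of the edges of `N₀` outside the tree, including the
  -- parallel copies of tree edges.
  let N₀ : Multigraph V :=
    { mult := fun u v => G.mult u v - edgeCount x y u v
      mult_comm := fun u v => by rw [G.mult_comm, edgeCount_comm]
      mult_self := fun v => by rw [G.mult_self, Nat.zero_sub] }
  have hN₀ : ∀ u v, G.mult u v = N₀.mult u v + edgeCount x y u v := fun u v =>
    (Nat.sub_add_cancel (hle u v)).symm
  obtain ⟨F, hroot, h0, hpar⟩ :=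
    (hG.connected_of_add_edge (by omega) hconn hxy hN₀).exists_rootedForest x
  have hF : ∀ u v, F.graph.mult u v ≤ N₀.mult u v := by
    intro u v
    have h1 := F.graph_le_one u v
    rcases Nat.eq_zero_or_pos (F.graph.mult u v) with h2 | h2
    · omega
    · rcases F.graph_pos.1 h2 with h3 | h3
      · have := hpar h3
        omega
      · have := hpar h3
        rw [N₀.mult_comm] at this
        omega
  let R : Multigraph V :=
    { mult := fun u v => N₀.mult u v - F.graph.mult u v
      mult_comm := fun u v => by rw [N₀.mult_comm, F.graph.mult_comm]
      mult_self := fun v => by rw [N₀.mult_self, Nat.zero_sub] }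
  obtain ⟨J, _, s, t, hst, hR⟩ := R.exists_edge_family
  -- The margin 2 makes every branch nonempty, even those that start two levels below `s j`.
  obtain ⟨D, hD⟩ : ∃ D, ∀ v, F.dep v + 2 ≤ D :=
    ⟨Finset.univ.sup F.dep + 2, fun v => Nat.add_le_add_right (Finset.le_sup (Finset.mem_univ v)) 2⟩
  have hpos : ∀ j (k : Fin (2 * h + 1)), 0 < gadgetHeight F s t D j k := by
    intro j k
    have h1 := hD (s j)
    have h2 := hD (t j)
    unfold gadgetHeight
    split_ifs <;> omega
  have hlab := fun j => Star.exists_labelling (m := 2 * h) (hpos j) (by simp) (by omega)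
  choose n hn lab hlt hlab using hlab
  let B : Multigraph V :=
    { mult := fun u v => F.graph.mult u v + edgeCount x y u v
      mult_comm := fun u v => by rw [F.graph.mult_comm, edgeCount_comm]
      mult_self := fun v => by rw [F.graph.mult_self, edgeCount_self hxy] }
  -- The same gadgets are used over two bases: the tree with `xy` gives `K`, the tree alone gives `N
  -- = K - xy`.
  let τ : Multigraph V → Substitution V J
      (fun j => Star (Fin (2 * h + 1)) (2 * h) (gadgetHeight F s t D j)) := fun B =>
    { base := B
      s := s
      t := t
      piece := fun j => Star.graph {0} (lab j) (hlt j)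
      x := fun _ => none
      y := fun j => Star.node 0 [] (hpos j 0) }
  have hτ : (τ B).Replaces G (fun j => Star.graph ∅ (lab j) (hlt j)) :=
    { s_ne_t := hst
      x_ne_y := fun j => Star.node_ne_none.symm
      base_eq := fun u v => by
        have h1 := hR u v
        have h2 := hF u v
        have h3 := hN₀ u v
        change _ = F.graph.mult u v + edgeCount x y u v + ∑ j, edgeCount (s j) (t j) u v
        rw [← h1]
        change _ = _ + (N₀.mult u v - F.graph.mult u v)
        omega
      piece_eq := fun j u v => by
        rw [Star.graph_empty_eq (hpos j) {0}]
        congr 1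
        rw [Finset.sum_eq_single 0 (fun k _ hk => by simp [hk]) (by simp)]
        simp [τ] }
  have hK : ∀ j, (Star.graph ∅ (lab j) (hlt j)).IsRGraph (2 * h + 1) := fun j =>
    have := hn j
    Star.graph_isRGraph (hpos j) (by simp) (hlab j) (hlt j) rfl hh
  refine ⟨_, inferInstance, (τ B).graph, (τ F.graph).graph, .inl x, .inl y,
    gadgetForest (2 * h) F s t D, D, fun e => hxy (Sum.inl.inj e), ?_, hτ.isRGraph hr hG hK,
    hτ.isObtainedFrom_base hr hG hK, ?_, h0, ?_, ?_⟩
  · rintro (u | p) (v | q)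
    · simp [Substitution.graph_inl_inl, edgeCount, τ, B]
    · simp [Substitution.graph_inl_inr, edgeCount, τ, Substitution.link]
    · simp [Substitution.graph_inr_inl, edgeCount, τ, Substitution.link]
    · simp [Substitution.graph_inr_inr, edgeCount, τ, Substitution.inner]
  · rintro (v | ⟨j, w⟩)
    · change (F.par v).map _ = none ↔ _
      rw [Option.map_eq_none_iff, hroot]
      simp
    · refine iff_of_false (fun e => ?_) (by simp)
      have e : gadgetPar F s t D (.inr ⟨j, w⟩) = none := e
      cases hp : Star.par {0} w with
      | some w' =>
        rw [gadgetPar_of_par hp] at e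
        cases e
      | none =>
        rcases Star.par_singleton_eq_none.1 hp with rfl | ⟨h', rfl⟩
        · rw [gadgetPar_none] at e
          cases e
        · rw [gadgetPar_root] at e
          cases e
  · exact gadgetForest_isTrimmed (fun j => hD _) (fun j => hD _) rfl rfl rfl (fun _ => rfl)
      (fun j => ⟨_, rfl⟩) fun j => ⟨_, _, _, _, rfl⟩
  · have := hD y
    change F.dep y < D
    omega

end Multigraph

/-! ### Rotating a star with equal branches -/

namespace Multigraph

section Rotation

variable {r m q : ℕ}

/-- The rotation of a star with equal branches. -/
def starShift (c : ZMod r) : Star (ZMod r) m (fun _ => q) → Star (ZMod r) m (fun _ => q)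
  | none => none
  | some ⟨j, b⟩ => some ⟨j + c, b⟩

theorem starShift_shift (c d : ZMod r) (v : Star (ZMod r) m (fun _ => q)) :
    starShift d (starShift c v) = starShift (c + d) v := by
  rcases v with _ | ⟨j, b⟩
  · rfl
  · simp only [starShift, add_assoc]

theorem starShift_zero (v : Star (ZMod r) m (fun _ => q)) : starShift 0 v = v := by
  rcases v with _ | ⟨j, b⟩
  · rfl
  · simp only [starShift, add_zero]

theorem starShift_injective (c : ZMod r) :
    Function.Injective (starShift (m := m) (q := q) c) := fun u v h => by
  have := congrArg (starShift (-c)) h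
  simpa only [starShift_shift, add_neg_cancel, starShift_zero] using this

theorem starShift_node (c j : ZMod r) (l : List (Fin m)) (h : l.length < q) :
    starShift c (Star.node (ht := fun _ => q) j l h) = Star.node (ht := fun _ => q) (j + c) l h :=
  rfl

theorem par_starShift (c : ZMod r) (v : Star (ZMod r) m (fun _ => q)) :
    Star.par Set.univ (starShift c v) = (Star.par Set.univ v).map (starShift c) := by
  rcases Star.cases v with rfl | ⟨j, h, rfl⟩ | ⟨j, a, l, h, rfl⟩
  · rfl
  · rw [starShift_node, Star.par_root, Star.par_root]
    simp
  · rw [starShift_node, Star.par_cons, Star.par_cons]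
    rfl

theorem starShift_mem_leaves {c : ZMod r} {v : Star (ZMod r) m (fun _ => q)} :
    starShift c v ∈ Star.leaves (fun _ : ZMod r => q) m ↔
      v ∈ Star.leaves (fun _ : ZMod r => q) m := by
  rcases v with _ | ⟨j, l, h⟩
  · rfl
  · exact Star.node_mem_leaves.trans
      (Star.node_mem_leaves (ht := fun _ : ZMod r => q) (h := h)).symm

end Rotation

theorem _root_.RootedForest.graph_mult_of_par {V : Type*} {F : RootedForest V} {f : V → V}
    (hf : Function.Injective f) (hpar : ∀ v, F.par (f v) = (F.par v).map f) (u v : V) :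
    F.graph.mult (f u) (f v) = F.graph.mult u v := by
  classical
  have h : ∀ u v, F.par (f u) = some (f v) ↔ F.par u = some v := fun u v => by
    rw [hpar, ← Option.map_some, (Option.map_injective hf).eq_iff]
  simp only [RootedForest.graph, h]

/-- A rotation adds a constant to the labels of the leaves, and circulant graphs are invariant under
translation. -/
theorem starGraph_shift {r m q N h : ℕ} {lab : Star (ZMod r) m (fun _ => q) → ZMod N}
    {d : ZMod N} (hlab : ∀ (j : ZMod r) (b : Branch m q),
      lab (some ⟨j + 1, b⟩) = lab (some ⟨j, b⟩) + d)
    (hN : 2 * h < N) (u v : Star (ZMod r) m (fun _ => q)) :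
    (Star.graph Set.univ lab hN).mult (starShift 1 u) (starShift 1 v) =
      (Star.graph Set.univ lab hN).mult u v := by
  classical
  have hl : ∀ v ∈ Star.leaves (fun _ : ZMod r => q) m, lab (starShift 1 v) = lab v + d := by
    rintro _ ⟨j, l, h, rfl, -⟩
    exact hlab j ⟨l, h⟩
  simp only [Star.graph]
  congr 1
  · exact RootedForest.graph_mult_of_par (F := Star.forest Set.univ (fun _ => q) m)
      (starShift_injective 1) (par_starShift 1) u v
  · simp only [leafGraph, starShift_mem_leaves]
    by_cases huv : u ∈ Star.leaves (fun _ : ZMod r => q) m ∧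
        v ∈ Star.leaves (fun _ : ZMod r => q) m
    · rw [if_pos huv, if_pos huv, hl u huv.1, hl v huv.2, circulant_add]
    · rw [if_neg huv, if_neg huv]

/-! ### The wheel: a copy of a trimmed graph in each edge at the root -/

section Wheel

variable {W : Type*} {r m q N h : ℕ}

/-- The substitution that inserts a copy of a graph into each edge at the root of a star. -/
noncomputable def wheel (P : Multigraph W) (x y : W) (hq : 0 < q)
    (lab : Star (ZMod r) m (fun _ => q) → ZMod N) (hN : 2 * h < N) :
    Substitution (Star (ZMod r) m (fun _ => q)) (ZMod r) (fun _ => W) where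
  base := Star.graph Set.univ lab hN
  s _ := none
  t j := Star.node j [] hq
  piece _ := P
  x _ := x
  y _ := y

/-- The vertices of a star with a copy of `W` in each branch. -/
abbrev WheelVertex (W : Type*) (r m q : ℕ) : Type _ :=
  Star (ZMod r) m (fun _ => q) ⊕ Σ _ : ZMod r, W

/-- The parents in the spanning tree. -/
noncomputable def wheelPar (F : RootedForest W) (y : W) :
    WheelVertex W r m q → Option (WheelVertex W r m q)
  | .inl none => none
  | .inl (some ⟨j, [], _⟩) => some (.inr ⟨j, y⟩)
  | .inl (some ⟨j, _ :: l, h⟩) => some (.inl (some ⟨j, l, (Nat.lt_succ_self _).trans h⟩))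
  | .inr ⟨j, w⟩ =>
    match F.par w with
    | some w' => some (.inr ⟨j, w'⟩)
    | none => some (.inl none)

/-- The depths in the spanning tree. -/
def wheelDep (F : RootedForest W) (y : W) : WheelVertex W r m q → ℕ
  | .inl none => 0
  | .inl (some ⟨_, l, _⟩) => F.dep y + 2 + l.length
  | .inr ⟨_, w⟩ => F.dep w + 1

variable {F : RootedForest W} {x y : W} {P : Multigraph W}

theorem wheelPar_of_par {j : ZMod r} {w w' : W} (h : F.par w = some w') :
    wheelPar (m := m) (q := q) F y (.inr ⟨j, w⟩) = some (.inr ⟨j, w'⟩) := by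
  simp only [wheelPar, h]

theorem wheelPar_of_root {j : ZMod r} {w : W} (h : F.par w = none) :
    wheelPar (m := m) (q := q) F y (.inr ⟨j, w⟩) = some (.inl none) := by
  simp only [wheelPar, h]

theorem wheelPar_of_starPar {u v : Star (ZMod r) m (fun _ => q)}
    (h : Star.par Set.univ u = some v) : wheelPar F y (.inl u) = some (.inl v) := by
  rcases Star.cases u with rfl | ⟨j, h', rfl⟩ | ⟨j, a, l, h', rfl⟩
  · cases h
  · rw [Star.par_root, if_pos (Set.mem_univ j)] at h
    cases h
  · rw [Star.par_cons] at h
    rw [← Option.some.inj h]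
    rfl

theorem wheelPar_inl {u : Star (ZMod r) m (fun _ => q)} {v : WheelVertex W r m q}
    (h : wheelPar F y (.inl u) = some v) :
    (∃ u', Star.par Set.univ u = some u' ∧ v = .inl u') ∨
      ∃ j h', u = Star.node (ht := fun _ : ZMod r => q) j [] h' ∧ v = .inr ⟨j, y⟩ := by
  rcases Star.cases u with rfl | ⟨j, h', rfl⟩ | ⟨j, a, l, h', rfl⟩
  · cases h
  · exact Or.inr ⟨j, h', rfl, (Option.some.inj h).symm⟩
  · exact Or.inl ⟨_, rfl, (Option.some.inj h).symm⟩

theorem wheelPar_inr {j : ZMod r} {w : W} {v : WheelVertex W r m q}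
    (h : wheelPar F y (.inr ⟨j, w⟩) = some v) :
    (∃ w', F.par w = some w' ∧ v = .inr ⟨j, w'⟩) ∨ F.par w = none ∧ v = .inl none := by
  cases hp : F.par w with
  | some w' =>
    rw [wheelPar_of_par hp] at h
    exact Or.inl ⟨w', rfl, (Option.some.inj h).symm⟩
  | none =>
    rw [wheelPar_of_root hp] at h
    exact Or.inr ⟨rfl, (Option.some.inj h).symm⟩

variable (F y r m q) in
/-- The spanning tree of a star with a copy of a graph in each edge at the root. -/
noncomputable def wheelForest (hroot : ∀ w, F.par w = none → F.dep w = 0) :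
    RootedForest (WheelVertex W r m q) where
  par := wheelPar F y
  dep := wheelDep F y
  dep_par := by
    rintro (u | ⟨j, w⟩) v h
    · rcases wheelPar_inl h with ⟨u', h1, rfl⟩ | ⟨j, h', rfl, rfl⟩
      · rcases u' with _ | ⟨k, l, hl⟩
        · obtain ⟨k, h2, hk, -⟩ := Star.par_eq_some_none.1 h1
          exact absurd (Set.mem_univ k) hk
        · obtain ⟨a, h2, rfl⟩ := Star.par_eq_some_node.1 h1
          rfl
      · rfl
    · rcases wheelPar_inr h with ⟨w', h1, rfl⟩ | ⟨h1, rfl⟩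
      · simp only [wheelDep, F.dep_par h1]
      · simp only [wheelDep, hroot w h1]

/-- Each copy of the tree hangs from the centre by `x`, and each branch of the star hangs from the
copy of `y`, so both links at a copy are tree edges and old depths grow by one. -/
theorem wheelForest_isTrimmed {D : ℕ} (hxy : x ≠ y) (hroot : ∀ w, F.par w = none ↔ w = x)
    (h0 : ∀ w, F.par w = none → F.dep w = 0) (hF : F.IsTrimmed P D) (hy : F.dep y < D)
    (hqD : q = D - F.dep y) (hq : 0 < q) (lab : Star (ZMod r) m (fun _ => q) → ZMod N)
    (hN : 2 * h < N) :
    (wheelForest r m q F y h0).IsTrimmed (wheel P x y hq lab hN).graph (D + 1) where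
  simple := by
    rintro (u | ⟨i, v⟩) (w | ⟨j, z⟩)
    · exact Star.graph_isSimple _ _ _ _ _
    · exact Substitution.link_le_one hxy
    · exact Substitution.link_le_one hxy
    · rw [Substitution.graph_inr_inr]
      by_cases hij : i = j
      · subst hij
        rw [Substitution.inner_same]
        exact hF.simple v z
      · rw [Substitution.inner_of_ne _ hij]
        simp
  par_adj := by
    rintro (u | ⟨j, w⟩) v h
    · rcases wheelPar_inl h with ⟨u', h1, rfl⟩ | ⟨j, h', rfl, rfl⟩
      · exact Star.graph_pos_of_par h1
      · exact Substitution.link_pos.2 (Or.inr ⟨rfl, rfl⟩)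
    · rcases wheelPar_inr (y := y) h with ⟨w', h1, rfl⟩ | ⟨h1, rfl⟩
      · rw [Substitution.graph_inr_inr, Substitution.inner_same]
        exact hF.par_adj h1
      · exact Substitution.link_pos.2 (Or.inl ⟨rfl, (hroot w).1 h1⟩)
  good := by
    have hlink : ∀ {u p}, 0 < (wheel P x y hq lab hN).link u p →
        wheelPar F y (.inr p) = some (.inl u) ∨ wheelPar F y (.inl u) = some (.inr p) := by
      rintro u ⟨j, w⟩ h
      rcases Substitution.link_pos.1 h with ⟨rfl, h2⟩ | ⟨rfl, h2⟩
      · exact Or.inl (wheelPar_of_root ((hroot w).2 h2))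
      · have h2 : w = y := h2
        subst h2
        exact Or.inr rfl
    rintro (v | ⟨j, w⟩)
    · by_cases hv : v ∈ Star.leaves (fun _ : ZMod r => q) m
      · left
        constructor
        · rintro (u | ⟨i, z⟩) h
          · rcases wheelPar_inl h with ⟨u', h1, h2⟩ | ⟨_, _, _, h2⟩
            · rw [← Sum.inl.inj h2] at h1
              exact Star.par_ne_of_mem_leaves hv h1
            · cases h2
          · rcases wheelPar_inr (y := y) h with ⟨_, _, h2⟩ | ⟨_, h2⟩
            · cases h2
            · rw [Sum.inl.inj h2] at hv
              exact Star.none_notMem_leaves hv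
        · obtain ⟨k, l, hl, rfl, hk⟩ := hv
          have hk : l.length + 1 = q := hk
          -- The top of a branch has depth `dep y + 2`, so its last level has depth `dep y + 1 + q =
          -- D + 1`.
          change F.dep y + 2 + l.length = D + 1
          omega
      · right
        rintro (u | p) h
        · rcases Star.graph_pos h with h | h | h
          · exact absurd h.1 hv
          · exact Or.inl (wheelPar_of_starPar h)
          · exact Or.inr (wheelPar_of_starPar h)
        · exact (hlink h).symm
    · rcases hF.good w with ⟨hw, hD⟩ | hw
      · left
        constructor
        · rintro (u | ⟨i, z⟩) h
          · rcases wheelPar_inl h with ⟨_, _, h2⟩ | ⟨i, _, _, h2⟩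
            · cases h2
            -- Only the copy of `y` acquires a new child, and `y` is not one of the leaves of depth
            -- `D`, since `F.dep y < D`.
            · cases h2
              omega
          · rcases wheelPar_inr (y := y) h with ⟨w', h1, h2⟩ | ⟨_, h2⟩
            · cases h2
              exact hw z h1
            · cases h2
        · exact congrArg (· + 1) hD
      · right
        rintro (u | ⟨i, z⟩) h
        · exact hlink h
        · rw [Substitution.graph_inr_inr] at h
          by_cases hij : j = i
          · subst hij
            rw [Substitution.inner_same] at h
            rcases hw z h with h | h
            · exact Or.inl (wheelPar_of_par (y := y) h)
            · exact Or.inr (wheelPar_of_par (y := y) h)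
          · rw [Substitution.inner_of_ne _ hij] at h
            exact absurd h (lt_irrefl 0)

/-- The rotation of a star with a copy of `W` in each branch. -/
def wheelShift (c : ZMod r) : WheelVertex W r m q → WheelVertex W r m q :=
  Sum.map (starShift c) fun p => ⟨p.1 + c, p.2⟩

theorem wheelShift_shift (c d : ZMod r) (v : WheelVertex W r m q) :
    wheelShift d (wheelShift c v) = wheelShift (c + d) v := by
  rcases v with v | ⟨j, w⟩
  · exact congrArg Sum.inl (starShift_shift c d v)
  · simp [wheelShift, add_assoc]

theorem wheelShift_zero (v : WheelVertex W r m q) : wheelShift 0 v = v := by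
  rcases v with v | ⟨j, w⟩
  · exact congrArg Sum.inl (starShift_zero v)
  · simp [wheelShift]

variable (W r m q) in
/-- The rotation by one step, as a permutation. -/
def wheelRotation : Equiv.Perm (WheelVertex W r m q) where
  toFun := wheelShift 1
  invFun := wheelShift (-1)
  left_inv v := by rw [wheelShift_shift, add_neg_cancel, wheelShift_zero]
  right_inv v := by rw [wheelShift_shift, neg_add_cancel, wheelShift_zero]

theorem wheelRotation_iterate (n : ℕ) (v : WheelVertex W r m q) :
    (wheelRotation W r m q)^[n] v = wheelShift (n : ZMod r) v := by
  induction n with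
  | zero => simp [wheelShift_zero]
  | succ n ih =>
    rw [Function.iterate_succ_apply', ih]
    change wheelShift 1 _ = _
    rw [wheelShift_shift, Nat.cast_succ]

theorem wheelShift_eq_self {c : ZMod r} {v : WheelVertex W r m q} (hv : v ≠ .inl none) :
    wheelShift c v = v ↔ c = 0 := by
  refine ⟨fun h => ?_, fun h => by rw [h, wheelShift_zero]⟩
  rcases v with (_ | ⟨j, b⟩) | ⟨j, w⟩
  · exact absurd rfl hv
  · have h : (some ⟨j + c, b⟩ : Star (ZMod r) m (fun _ => q)) = some ⟨j, b⟩ := Sum.inl.inj h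
    have := congrArg Sigma.fst (Option.some.inj h)
    simpa using this
  · have := congrArg Sigma.fst (Sum.inr.inj h)
    simpa using this

/-- Every vertex except the centre carries an index in `ZMod r`, which `n` rotations shift by `n`;
it returns exactly when `r` divides `n`. -/
theorem minimalPeriod_wheelRotation {v : WheelVertex W r m q} (hv : v ≠ .inl none) :
    Function.minimalPeriod (wheelRotation W r m q) v = r := by
  have key : ∀ n : ℕ, Function.IsPeriodicPt (wheelRotation W r m q) n v ↔ r ∣ n := by
    intro n
    rw [Function.IsPeriodicPt, Function.IsFixedPt, wheelRotation_iterate, wheelShift_eq_self hv,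
      ZMod.natCast_eq_zero_iff]
  refine Nat.dvd_antisymm ?_ ((key _).1 (Function.isPeriodicPt_minimalPeriod _ _))
  exact ((key r).2 dvd_rfl).minimalPeriod_dvd

theorem wheelPar_rotation (v : WheelVertex W r m q) :
    wheelPar F y (wheelRotation W r m q v) = (wheelPar F y v).map (wheelRotation W r m q) := by
  rcases v with v | ⟨j, w⟩
  · rcases Star.cases v with rfl | ⟨j, h, rfl⟩ | ⟨j, a, l, h, rfl⟩ <;> rfl
  · change wheelPar F y (.inr ⟨j + 1, w⟩) = _
    cases hp : F.par w with
    | some w' =>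
      rw [wheelPar_of_par hp, wheelPar_of_par hp]
      rfl
    | none =>
      rw [wheelPar_of_root hp, wheelPar_of_root hp]
      rfl

theorem wheel_isAutomorphism {lab : Star (ZMod r) m (fun _ => q) → ZMod N} {d : ZMod N}
    (hlab : ∀ (j : ZMod r) (b : Branch m q), lab (some ⟨j + 1, b⟩) = lab (some ⟨j, b⟩) + d)
    (hq : 0 < q) (hN : 2 * h < N) :
    (wheel P x y hq lab hN).graph.IsAutomorphism (wheelRotation W r m q) := by
  have hlink : ∀ u (j : ZMod r) w, (wheel P x y hq lab hN).link (starShift 1 u) ⟨j + 1, w⟩ =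
      (wheel P x y hq lab hN).link u ⟨j, w⟩ := by
    intro u j w
    have h1 : starShift 1 u = none ↔ u = none := by
      rw [show (none : Star (ZMod r) m (fun _ => q)) = starShift 1 none from rfl,
        (starShift_injective 1).eq_iff]
      rfl
    have h2 : starShift 1 u = Star.node (ht := fun _ : ZMod r => q) (j + 1) [] hq ↔
        u = Star.node (ht := fun _ : ZMod r => q) j [] hq := by
      rw [← starShift_node, (starShift_injective 1).eq_iff]
    exact Substitution.link_congr (and_congr_left' h1) (and_congr_left' h2)
  rintro (u | ⟨i, v⟩) (w | ⟨j, z⟩)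
  · exact starGraph_shift hlab hN u w
  · exact hlink u j z
  · exact hlink w i v
  · change (wheel P x y hq lab hN).inner ⟨i + 1, v⟩ ⟨j + 1, z⟩ =
      (wheel P x y hq lab hN).inner ⟨i, v⟩ ⟨j, z⟩
    by_cases hij : i = j
    · subst hij
      rw [Substitution.inner_same, Substitution.inner_same]
      rfl
    · rw [Substitution.inner_of_ne _ (fun e => hij (add_right_cancel e)),
        Substitution.inner_of_ne _ hij]

end Wheel

/-! ### Assembling the rotation graph -/

/-- The theorem for `r ≥ 3`. -/
theorem IsRGraph.exists_rotation {V : Type u} [Fintype V] {G : Multigraph V} {h : ℕ} (hh : 0 < h)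
    (hG : G.IsRGraph (2 * h + 1)) (hconn : G.Connected) :
    ∃ (V' : Type u) (_ : Fintype V') (G' : Multigraph V'),
      G'.IsSimple ∧ G'.IsRotationRGraph (2 * h + 1) ∧ G.IsObtainedFrom (2 * h + 1) G' := by
  classical
  have hr : Odd (2 * h + 1) := odd_two_mul_add_one h
  obtain ⟨W, _, K, P, x, y, F, D, hxy, hKP, hK, hobt, hroot, h0, hF, hy⟩ :=
    hG.exists_trimmed hh hconn
  have h0' : ∀ w, F.par w = none → F.dep w = 0 := fun w hw => by rw [(hroot w).1 hw, h0]
  obtain ⟨q, hqD⟩ : ∃ q, q = D - F.dep y := ⟨_, rfl⟩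
  have hq : 0 < q := by omega
  obtain ⟨N, _, lab, d, hN, hlab, hequiv⟩ :=
    Star.exists_equivariant_labelling (m := 2 * h) (r := 2 * h + 1) (by omega) (by omega) hq
  have hstar := Star.graph_isRGraph (ht := fun _ : ZMod (2 * h + 1) => q) (fun _ => hq)
    (ZMod.card _) hlab hN rfl hh
  have hrep : (wheel P x y hq lab hN).Replaces (Star.graph ∅ lab hN) (fun _ => K) :=
    { s_ne_t := fun _ => Star.node_ne_none.symm
      x_ne_y := fun _ => hxy
      base_eq := fun u v => by
        rw [Star.graph_empty_eq (fun _ => hq) Set.univ]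
        simp [wheel]
      piece_eq := fun _ => hKP }
  have hgraph := hrep.isRGraph hr hstar fun _ => hK
  have htrim := wheelForest_isTrimmed hxy hroot h0' hF hy hqD hq lab hN
  have hroot' : ∀ v, (wheelForest (2 * h + 1) (2 * h) q F y h0').par v = none ↔ v = .inl none := by
    intro v
    refine ⟨fun hv => ?_, fun hv => by rw [hv]; rfl⟩
    have hv : wheelPar F y v = none := hv
    rcases v with v | ⟨j, w⟩
    · rcases Star.cases v with rfl | ⟨j, h, rfl⟩ | ⟨j, a, l, h, rfl⟩
      · rfl
      · cases hv
      · cases hv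
    · cases hp : F.par w with
      | some w' =>
        rw [wheelPar_of_par hp] at hv
        cases hv
      | none =>
        rw [wheelPar_of_root hp] at hv
        cases hv
  have htree := htrim.isRootedTree hgraph.1 (by omega) hroot' rfl (Nat.succ_ne_zero D)
  refine ⟨_, inferInstance, (wheel P x y hq lab hN).graph, htrim.simple,
    ⟨hgraph, D + 1, hgraph.1, (wheelForest (2 * h + 1) (2 * h) q F y h0').tree, .inl none,
      wheelRotation W (2 * h + 1) (2 * h) q, htrim.tree_le, htree,
      wheel_isAutomorphism hequiv hq hN, ?_, ?_, ?_⟩,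
    -- Any copy would do: keeping the one with index 0 gives `K`, which reduces further to `G`.
    hrep.isObtainedFrom_piece hr hgraph 0 hobt⟩
  · have hpar : ∀ u v : WheelVertex W (2 * h + 1) (2 * h) q,
        wheelPar F y (wheelRotation W (2 * h + 1) (2 * h) q u) =
          some (wheelRotation W (2 * h + 1) (2 * h) q v) ↔ wheelPar F y u = some v := by
      intro u v
      rw [wheelPar_rotation, ← Option.map_some,
        (Option.map_injective (wheelRotation W (2 * h + 1) (2 * h) q).injective).eq_iff]
    exact fun u v => or_congr (hpar u v) (hpar v u)
  · rw [Function.minimalPeriod_eq_one_iff_isFixedPt]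
    rfl
  · intro v hv
    rw [minimalPeriod_wheelRotation hv]
    exact htree.2.2.1.symm

/-- With all degrees 1, every vertex other than the root must have the root as parent. The identity
is rotational because the required period is the degree 1 of the root. -/
theorem IsRGraph.isRotationRGraph_one {V : Type u} [Fintype V] {G : Multigraph V}
    (hG : G.IsRGraph 1) (hconn : G.Connected) : G.IsSimple ∧ G.IsRotationRGraph 1 := by
  classical
  have hle : ∀ u v, G.mult u v ≤ 1 := fun u v => by
    rw [← hG.1 u]
    exact Finset.single_le_sum (f := fun v => G.mult u v) (fun _ _ => Nat.zero_le _)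
      (Finset.mem_univ v)
  have huniq : ∀ {u v w}, 0 < G.mult u v → 0 < G.mult u w → v = w := by
    intro u v w hv hw
    by_contra hne
    have h1 : ∑ z ∈ {v, w}, G.mult u z ≤ G.degree u :=
      Finset.sum_le_sum_of_subset (Finset.subset_univ _)
    rw [hG.1 u, Finset.sum_pair hne] at h1
    omega
  obtain ⟨x⟩ := hconn.nonempty
  obtain ⟨F, hroot, h0, hpar⟩ := hconn.exists_rootedForest x
  have hparx : ∀ v, v ≠ x → F.par v = some x := by
    intro v hv
    obtain ⟨p, hp⟩ := Option.ne_none_iff_exists'.1 fun h => hv ((hroot _).1 h)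
    cases hp' : F.par p with
    | none => rw [hp, (hroot p).1 hp']
    | some p' =>
      have h1 := hpar hp
      rw [G.mult_comm] at h1
      obtain rfl := huniq h1 (hpar hp')
      exact absurd hp' (F.not_par_par hp)
  have hdep : ∀ v, v ≠ x → F.dep v = 1 := fun v hv => by rw [F.dep_par (hparx v hv), h0]
  have htrim : F.IsTrimmed G 1 :=
    { simple := hle
      par_adj := hpar
      good := fun v => by
        by_cases hv : v = x
        · subst hv
          refine Or.inr fun u hu => Or.inr (hparx u ?_)
          rintro rfl
          rw [G.mult_self] at hu
          exact lt_irrefl 0 hu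
        · refine Or.inl ⟨fun u hu => hv ?_, hdep v hv⟩
          by_cases hux : u = x
          · rw [(hroot u).2 hux] at hu
            cases hu
          · rw [hparx u hux] at hu
            exact (Option.some.inj hu).symm }
  have htree := htrim.isRootedTree hG.1 (fun _ => hdep) hroot h0 one_ne_zero
  refine ⟨hle, hG, 1, hG.1, F.tree, x, 1, htrim.tree_le, htree, fun _ _ => rfl,
    fun _ _ => Iff.rfl, ?_, fun v _ => ?_⟩
  · rw [Function.minimalPeriod_eq_one_iff_isFixedPt]
    rfl
  · rw [htree.2.2.1, Function.minimalPeriod_eq_one_iff_isFixedPt]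
    rfl

end Multigraph

theorem theorem1 (r : ℕ) (hr : Odd r) {V : Type u} [Fintype V] (G : Multigraph V)
    (hG : G.IsRGraph r) (hconn : G.Connected) :
    ∃ (V' : Type u) (_ : Fintype V') (G' : Multigraph V'),
      G'.IsSimple ∧ G'.IsRotationRGraph r ∧ G.IsObtainedFrom r G' := by
  obtain ⟨h, rfl⟩ := hr
  rcases Nat.eq_zero_or_pos h with rfl | hh
  · obtain ⟨hsimple, hrot⟩ := hG.isRotationRGraph_one hconn
    exact ⟨V, inferInstance, G, hsimple, hrot, .iso G ⟨Equiv.refl V, fun _ _ => rfl⟩⟩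
  · exact hG.exists_rotation hh hconn
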